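/- **Setting.** Let $\mathbf{Box}$ be the category whose objects are maps $S\to I$ of finite sets (written $S/I$) and whose morphisms $S'/I'\to S/I$ are commutative squares $(\varphi:S'\to S,\ \bar\varphi:I'\to I)$ such that $\varphi$ is injective on each fibre $S'_{i'}$, $i'\in I'$. A *context* of $S/I$ is a subset $c\subset S$ on which $S\to I$ is injective; $\mathscr C_{S/I}$ is the set of contexts, ordered by inclusion. A morphism as above induces the monotone map $\phi:\mathscr C_{S/I}\to\mathscr C_{S'/I'}$, $c\mapsto\varphi^{-1}(c)$. $\mathbf{Loc}$ is the category of locales (the opposite of the category of frames) and $\mathbf{Loc}^\to$ its arrow category. **Kripke topoi.** For a poset $\mathscr C$, internal bounded distributive lattices in $\mathbf{Set}^{\mathscr C}$ are functors $L$ from $\mathscr C$ to bounded distributive lattices. The internal ideal completion $\mathrm{Idl}\,L$ sends $c$ to the lattice of subfunctors $J$ of $L|_{\{d\,\ge\, c\}}$ such that each $J(d)$ is an order ideal (nonempty, lower, directed) of $L(d)$. It is a monad (unit: principal ideals; multiplication: union), and internal frames are its Eilenberg–Moore algebras. The subobject classifier $\Omega$, with $\Omega(c)$ the set of upper subsets of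 $\{d\ge c\}$, is the initial internal frame. A monotone map $\phi:\mathscr C\to\mathscr C'$ induces a geometric morphism $\mathbf{Set}^{\mathscr C}\to\mathbf{Set}^{\mathscr C'}$ with direct image $(\phi_*L)(c')=\lim_{c'\le\phi(c)}L(c)$; via the canonical morphism $\mathrm{Idl}\,\phi_*\to\phi_*\,\mathrm{Idl}$ the functor $\phi_*$ acts on internal frames. For $f:\mathbf{Set}^{\mathscr C}\to\mathbf{Set}$, induced by $\mathscr C\to *$, this gives a functor $f_*$ from internal frames to frames. A morphism $(\mathbf{Set}^{\mathscr C},F)\to(\mathbf{Set}^{\mathscr C'},F')$ of framed Kripke topoi consists of a monotone map $\phi:\mathscr C\to\mathscr C'$ and a homomorphism of internal frames $F'\to\phi_*F$ (equivalently, $\phi^\sharp F'\to F$ for the left adjoint $\phi^\sharp$ of $\phi_*$ on internal frames). **The functor $\mathscr X$.** Let $L_{S/I}:\mathscr C_{S/I}\to\mathbf{Bool}$ send a context $c$ to the free Boolean algebra on the set $c$, and let $F_{S/I}=\mathrm{Idl}\,L_{S/I}$. A morphism $S'/I'\to S/I$ induces a homomorphism $\phi^*L_{S'/I'}\to L_{S/I}$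 (freely extending the maps $\varphi:\varphi^{-1}(c)\to c$), hence by transposition $L_{S'/I'}\to\phi_*L_{S/I}$, hence a homomorphism of internal frames $$F_{S'/I'}=\mathrm{Idl}\,L_{S'/I'}\to\mathrm{Idl}\,\phi_*L_{S/I}\to\phi_*\,\mathrm{Idl}\,L_{S/I}=\phi_*F_{S/I}.$$ This defines a functor $S/I\mapsto(\mathbf{Set}^{\mathscr C_{S/I}},F_{S/I})$ from $\mathbf{Box}^{\mathrm{op}}$ to framed Kripke topoi. The *external phase space* functor $\mathscr X:\mathbf{Box}^{\mathrm{op}}\to\mathbf{Loc}^\to$ is its composite with the functor sending $(\mathscr E,F)$ to the morphism of locales given by the frame homomorphism $f_*\Omega\to f_*F$, and sending a morphism $(\phi,\ F'\to\phi_*F)$ to the square of locale morphisms given by the frame homomorphisms $f'_*F'\to f'_*\phi_*F=f_*F$ and $f'_*\Omega'\to f'_*\phi_*\Omega=f_*\Omega$. **The functor $\tilde{\mathscr X}$.** Let $X_{S/I}$ be the set of pairs $(c,x)$ with $c\in\mathscr C_{S/I}$ and $x:c\to 2$ (*outcomes*), ordered by $(c',x')\le(c,x)$ iff $c'\subset c$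 and $x|_{c'}=x'$. Equip posets with the Alexandrov topology (open sets are the upper sets) and regard the resulting spaces as locales. The functor $\tilde{\mathscr X}:\mathbf{Box}^{\mathrm{op}}\to\mathbf{Loc}^\to$ sends $S/I$ to the projection $X_{S/I}\to\mathscr C_{S/I}$, $(c,x)\mapsto c$, and a morphism $S'/I'\to S/I$ over $\varphi$ to the square consisting of $X_{S/I}\to X_{S'/I'}$, $(c,x)\mapsto(\varphi^{-1}(c),\,x\circ\varphi|_{\varphi^{-1}(c)})$, and $\mathscr C_{S/I}\to\mathscr C_{S'/I'}$, $c\mapsto\varphi^{-1}(c)$. **Lemma.** The functors $\tilde{\mathscr X}$ and $\mathscr X$ from $\mathbf{Box}^{\mathrm{op}}$ to $\mathbf{Loc}^\to$ are naturally isomorphic. -/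

import Mathlib

open CategoryTheory Opposite

universe u

namespace BoxWorld

/-! ### Free Boolean algebras -/

/-- Formal Boolean expressions in variables from `X`. -/
inductive BoolTerm (X : Type u) : Type u
  | var (x : X) : BoolTerm X
  | top : BoolTerm X
  | bot : BoolTerm X
  | inf (s t : BoolTerm X) : BoolTerm X
  | sup (s t : BoolTerm X) : BoolTerm X
  | compl (s : BoolTerm X) : BoolTerm X

/-- The value of an expression in a Boolean algebra. -/
def BoolTerm.eval {X B : Type u} [BooleanAlgebra B] (v : X → B) : BoolTerm X → B
  | .var x => v x
  | .top => ⊤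
  | .bot => ⊥
  | .inf s t => s.eval v ⊓ t.eval v
  | .sup s t => s.eval v ⊔ t.eval v
  | .compl s => (s.eval v)ᶜ

/-- Two expressions are identified if they are equal under every valuation in every Boolean
algebra. -/
instance BoolTerm.setoid (X : Type u) : Setoid (BoolTerm X) where
  r s t := ∀ (B : Type u) [BooleanAlgebra B] (v : X → B), s.eval v = t.eval v
  iseqv :=
    { refl := fun _ _ _ _ => rfl
      symm := fun h B _ v => (h B v).symm
      trans := fun h k B _ v => (h B v).trans (k B v) }

/-- The free Boolean algebra on `X`. -/
def FreeBool (X : Type u) : Type u := Quotient (BoolTerm.setoid X)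

namespace FreeBool

variable {X Y : Type u}

/-- Evaluation of an element of the free Boolean algebra along a valuation of the generators. -/
def eval {B : Type u} [BooleanAlgebra B] (v : X → B) : FreeBool X → B :=
  Quotient.lift (BoolTerm.eval v) fun _ _ h => h B v

/-- The generators. -/
def of (x : X) : FreeBool X := Quotient.mk _ (.var x)

/-- The class of an expression. -/
def mk (s : BoolTerm X) : FreeBool X := Quotient.mk _ s

theorem ext_eval {a b : FreeBool X}
    (h : ∀ (B : Type u) [BooleanAlgebra B] (v : X → B), eval v a = eval v b) : a = b := by
  induction a using Quotient.inductionOn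
  induction b using Quotient.inductionOn
  exact Quotient.sound h

instance : Min (FreeBool X) :=
  ⟨Quotient.map₂ .inf fun _ _ h _ _ k B _ v => congrArg₂ (· ⊓ ·) (h B v) (k B v)⟩

instance : Max (FreeBool X) :=
  ⟨Quotient.map₂ .sup fun _ _ h _ _ k B _ v => congrArg₂ (· ⊔ ·) (h B v) (k B v)⟩

instance : Compl (FreeBool X) :=
  ⟨Quotient.map .compl fun _ _ h B _ v => congrArg (·ᶜ) (h B v)⟩

instance : Top (FreeBool X) := ⟨Quotient.mk _ .top⟩

instance : Bot (FreeBool X) := ⟨Quotient.mk _ .bot⟩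

instance : LE (FreeBool X) :=
  ⟨fun a b => ∀ (B : Type u) [BooleanAlgebra B] (v : X → B), eval v a ≤ eval v b⟩

section

variable {B : Type u} [BooleanAlgebra B] (v : X → B)

@[simp] theorem eval_of (x : X) : eval v (of x) = v x := rfl

@[simp] theorem eval_top : eval v ⊤ = ⊤ := rfl

@[simp] theorem eval_bot : eval v ⊥ = ⊥ := rfl

@[simp] theorem eval_inf (a b : FreeBool X) : eval v (a ⊓ b) = eval v a ⊓ eval v b := by
  induction a using Quotient.inductionOn
  induction b using Quotient.inductionOn
  rfl

@[simp] theorem eval_sup (a b : FreeBool X) : eval v (a ⊔ b) = eval v a ⊔ eval v b := by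
  induction a using Quotient.inductionOn
  induction b using Quotient.inductionOn
  rfl

@[simp] theorem eval_compl (a : FreeBool X) : eval v aᶜ = (eval v a)ᶜ := by
  induction a using Quotient.inductionOn
  rfl

end

instance : DistribLattice (FreeBool X) where
  le_refl _ _ _ _ := le_rfl
  le_trans _ _ _ h k B _ v := (h B v).trans (k B v)
  le_antisymm _ _ h k := ext_eval fun B _ v => le_antisymm (h B v) (k B v)
  sup a b := a ⊔ b
  inf a b := a ⊓ b
  le_sup_left a b B _ v := by rw [eval_sup]; exact le_sup_left
  le_sup_right a b B _ v := by rw [eval_sup]; exact le_sup_right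
  sup_le a b c h k B _ v := by rw [eval_sup]; exact sup_le (h B v) (k B v)
  inf_le_left a b B _ v := by rw [eval_inf]; exact inf_le_left
  inf_le_right a b B _ v := by rw [eval_inf]; exact inf_le_right
  le_inf a b c h k B _ v := by rw [eval_inf]; exact le_inf (h B v) (k B v)
  le_sup_inf a b c B _ v := by
    change eval v ((a ⊔ b) ⊓ (a ⊔ c)) ≤ eval v (a ⊔ b ⊓ c)
    revert a b c
    rintro ⟨a⟩ ⟨b⟩ ⟨c⟩
    exact le_sup_inf (x := a.eval v)

instance : BooleanAlgebra (FreeBool X) where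
  inf_compl_le_bot := by
    rintro ⟨a⟩ B _ v
    exact BooleanAlgebra.inf_compl_le_bot (a.eval v)
  top_le_sup_compl := by
    rintro ⟨a⟩ B _ v
    exact BooleanAlgebra.top_le_sup_compl (a.eval v)
  le_top a B _ v := le_top (a := eval v a)
  bot_le a B _ v := bot_le (a := eval v a)

/-- The homomorphism out of the free Boolean algebra determined by the images of the generators. -/
def lift {B : Type u} [BooleanAlgebra B] (v : X → B) : BoundedLatticeHom (FreeBool X) B where
  toFun := eval v
  map_sup' := eval_sup v
  map_inf' := eval_inf v
  map_top' := eval_top v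
  map_bot' := eval_bot v

@[simp] theorem lift_of {B : Type u} [BooleanAlgebra B] (v : X → B) (x : X) :
    lift v (of x) = v x := rfl

theorem hom_ext {B : Type u} [BooleanAlgebra B] {f g : BoundedLatticeHom (FreeBool X) B}
    (h : ∀ x, f (of x) = g (of x)) : f = g := by
  ext a
  induction a using Quotient.inductionOn with
  | h a =>
    change f (mk a) = g (mk a)
    induction a with
    | var x => exact h x
    | top => exact (map_top f).trans (map_top g).symm
    | bot => exact (map_bot f).trans (map_bot g).symm
    | inf s t hs ht =>
      exact (f.map_inf' (mk s) (mk t)).trans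
        ((congrArg₂ (· ⊓ ·) hs ht).trans (g.map_inf' (mk s) (mk t)).symm)
    | sup s t hs ht =>
      exact (f.map_sup' (mk s) (mk t)).trans
        ((congrArg₂ (· ⊔ ·) hs ht).trans (g.map_sup' (mk s) (mk t)).symm)
    | compl s hs =>
      exact (map_compl' f (mk s)).trans
        ((congrArg (·ᶜ) hs).trans (map_compl' g (mk s)).symm)

/-- The universal property: homomorphisms out of `FreeBool X` are maps out of `X`. -/
def liftEquiv (B : Type u) [BooleanAlgebra B] :
    (X → B) ≃ BoundedLatticeHom (FreeBool X) B where
  toFun := lift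
  invFun f x := f (of x)
  left_inv _ := rfl
  right_inv _ := hom_ext fun _ => rfl

/-- The action of the free Boolean algebra functor on maps. -/
def map (f : X → Y) : BoundedLatticeHom (FreeBool X) (FreeBool Y) := lift fun x => of (f x)

@[simp] theorem map_of (f : X → Y) (x : X) : map f (of x) = of (f x) := rfl

end FreeBool

/-- The free Boolean algebra functor. -/
def freeBool : Type u ⥤ BoolAlg.{u} where
  obj X := BoolAlg.of (FreeBool X)
  map f := BoolAlg.ofHom (FreeBool.map f)
  map_id _ := BoolAlg.hom_ext (FreeBool.hom_ext fun _ => rfl)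
  map_comp _ _ := BoolAlg.hom_ext (FreeBool.hom_ext fun _ => rfl)

/-! ### The internal ideal completion in a Kripke topos

For a poset `C`, internal distributive lattices in the Kripke topos `Set^C` are functors from `C`
to bounded distributive lattices. -/

/-- The ideal generated by the image of an ideal under a homomorphism. -/
def pushIdeal {P Q : Type u} [DistribLattice P] [BoundedOrder P] [DistribLattice Q]
    [BoundedOrder Q] (f : BoundedLatticeHom P Q) (I : Order.Ideal P) : Order.Ideal Q where
  carrier := {y | ∃ x ∈ I, y ≤ f x}
  lower' := fun _ _ hab ⟨x, hx, hy⟩ => ⟨x, hx, hab.trans hy⟩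
  nonempty' := ⟨⊥, ⊥, I.bot_mem, bot_le⟩
  directed' := fun y ⟨x, hx, hy⟩ y' ⟨x', hx', hy'⟩ =>
    ⟨y ⊔ y', ⟨x ⊔ x', Order.Ideal.sup_mem hx hx', by rw [map_sup]; exact sup_le_sup hy hy'⟩,
      le_sup_left, le_sup_right⟩

section pushIdeal

variable {P Q R : Type u} [DistribLattice P] [BoundedOrder P] [DistribLattice Q]
    [BoundedOrder Q] [DistribLattice R] [BoundedOrder R] (f : BoundedLatticeHom P Q)

@[simp] theorem mem_pushIdeal {I : Order.Ideal P} {y : Q} :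
    y ∈ pushIdeal f I ↔ ∃ x ∈ I, y ≤ f x := Iff.rfl

theorem pushIdeal_sup (I J : Order.Ideal P) :
    pushIdeal f (I ⊔ J) = pushIdeal f I ⊔ pushIdeal f J := by
  apply le_antisymm
  · rintro y ⟨x, ⟨i, hi, j, hj, hx⟩, hy⟩
    exact ⟨f i, ⟨i, hi, le_rfl⟩, f j, ⟨j, hj, le_rfl⟩,
      hy.trans ((OrderHomClass.mono f hx).trans (map_sup f i j).le)⟩
  · refine sup_le ?_ ?_
    · rintro y ⟨x, hx, hy⟩
      exact ⟨x, (le_sup_left : I ≤ I ⊔ J) hx, hy⟩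
    · rintro y ⟨x, hx, hy⟩
      exact ⟨x, (le_sup_right : J ≤ I ⊔ J) hx, hy⟩

theorem pushIdeal_inf (I J : Order.Ideal P) :
    pushIdeal f (I ⊓ J) = pushIdeal f I ⊓ pushIdeal f J := by
  ext y
  constructor
  · rintro ⟨x, hx, hy⟩
    exact ⟨⟨x, hx.1, hy⟩, ⟨x, hx.2, hy⟩⟩
  · rintro ⟨⟨x, hx, hy⟩, ⟨x', hx', hy'⟩⟩
    exact ⟨x ⊓ x', ⟨I.lower inf_le_left hx, J.lower inf_le_right hx'⟩,
      (le_inf hy hy').trans (map_inf f x x').ge⟩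

theorem pushIdeal_top : pushIdeal f ⊤ = ⊤ := by
  apply top_unique
  rintro y -
  exact ⟨⊤, trivial, by simp⟩

theorem pushIdeal_bot : pushIdeal f ⊥ = ⊥ := by
  apply bot_unique
  rintro y ⟨x, hx, hy⟩
  have hx' : x ≤ ⊥ := hx
  have : x = ⊥ := le_bot_iff.mp hx'
  subst this
  rw [map_bot] at hy
  exact hy

theorem ideal_le_sup_inf (I J K : Order.Ideal P) : (I ⊔ J) ⊓ (I ⊔ K) ≤ I ⊔ J ⊓ K := by
  rintro x ⟨⟨i, hi, j, hj, h⟩, ⟨i', hi', k, hk, h'⟩⟩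
  refine ⟨i ⊔ i', Order.Ideal.sup_mem hi hi', j ⊓ k,
    ⟨J.lower inf_le_left hj, K.lower inf_le_right hk⟩, ?_⟩
  rw [sup_inf_left]
  exact le_inf (h.trans (sup_le_sup_right le_sup_left j))
    (h'.trans (sup_le_sup_right le_sup_right k))

end pushIdeal

section Kripke

variable {C D E : Type u} [PartialOrder C] [PartialOrder D] [PartialOrder E]

/-- Transition maps of an internal distributive lattice. -/
def res (L : C ⥤ BddDistLat.{u}) {c d : C} (h : c ≤ d) : BoundedLatticeHom (L.obj c) (L.obj d) :=
  (L.map (homOfLE h)).hom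

@[simp] theorem res_self (L : C ⥤ BddDistLat.{u}) {c : C} (h : c ≤ c) (x : L.obj c) :
    res L h x = x := by
  simp [res]

@[simp] theorem res_res (L : C ⥤ BddDistLat.{u}) {c d e : C} (h : c ≤ d) (k : d ≤ e)
    (x : L.obj c) : res L k (res L h x) = res L (h.trans k) x := by
  have : L.map (homOfLE (h.trans k)) = L.map (homOfLE h) ≫ L.map (homOfLE k) :=
    (L.map_comp _ _)
  simp [res, this]

theorem app_res {L M : C ⥤ BddDistLat.{u}} (α : L ⟶ M) {c d : C} (h : c ≤ d) (x : L.obj c) :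
    α.app d (res L h x) = res M h (α.app c x) :=
  ConcreteCategory.congr_hom (α.naturality (homOfLE h)) x

/-- A subfunctor of the restriction of `L` to `{d | c ≤ d}` whose values are order ideals. -/
@[ext]
structure IdealFamily (L : C ⥤ BddDistLat.{u}) (c : C) : Type u where
  ideal : ∀ d, c ≤ d → Order.Ideal (L.obj d)
  res_mem : ∀ {d e : C} (hd : c ≤ d) (h : d ≤ e) {x : L.obj d}, x ∈ ideal d hd →
    res L h x ∈ ideal e (hd.trans h)

namespace IdealFamily

variable {L M N : C ⥤ BddDistLat.{u}} {c : C}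

theorem ext_mem {I J : IdealFamily L c}
    (h : ∀ d hd x, x ∈ I.ideal d hd ↔ x ∈ J.ideal d hd) : I = J := by
  apply IdealFamily.ext
  funext d hd
  exact SetLike.ext (h d hd)

instance : DistribLattice (IdealFamily L c) where
  le I J := ∀ d hd, I.ideal d hd ≤ J.ideal d hd
  le_refl _ _ _ := le_rfl
  le_trans _ _ _ h k d hd := (h d hd).trans (k d hd)
  le_antisymm _ _ h k := ext_mem fun d hd _ => ⟨fun hx => h d hd hx, fun hx => k d hd hx⟩
  sup I J :=
    { ideal := fun d hd => I.ideal d hd ⊔ J.ideal d hd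
      res_mem := by
        rintro d e hd h x ⟨i, hi, j, hj, hx⟩
        exact ⟨_, I.res_mem hd h hi, _, J.res_mem hd h hj,
          (OrderHomClass.mono (res L h) hx).trans (map_sup _ _ _).le⟩ }
  inf I J :=
    { ideal := fun d hd => I.ideal d hd ⊓ J.ideal d hd
      res_mem := fun hd h _ hx => ⟨I.res_mem hd h hx.1, J.res_mem hd h hx.2⟩ }
  le_sup_left I J d hd := le_sup_left (a := I.ideal d hd)
  le_sup_right I J d hd := le_sup_right (a := I.ideal d hd)
  sup_le I J K h k d hd := sup_le (h d hd) (k d hd)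
  inf_le_left I J d hd := inf_le_left (a := I.ideal d hd)
  inf_le_right I J d hd := inf_le_right (a := I.ideal d hd)
  le_inf I J K h k d hd := le_inf (h d hd) (k d hd)
  le_sup_inf I J K d hd := ideal_le_sup_inf (I.ideal d hd) (J.ideal d hd) (K.ideal d hd)

instance : BoundedOrder (IdealFamily L c) where
  top := { ideal := fun _ _ => ⊤, res_mem := fun _ _ _ _ => trivial }
  le_top _ _ _ := le_top
  bot :=
    { ideal := fun _ _ => ⊥
      res_mem := by
        intro d e hd h x hx
        have hx' : x ≤ ⊥ := hx
        rw [le_bot_iff.mp hx', map_bot]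
        exact Order.Ideal.bot_mem _ }
  bot_le _ _ _ := bot_le

@[simp] theorem ideal_sup (I J : IdealFamily L c) (d : C) (hd : c ≤ d) :
    (I ⊔ J).ideal d hd = I.ideal d hd ⊔ J.ideal d hd := rfl

@[simp] theorem ideal_inf (I J : IdealFamily L c) (d : C) (hd : c ≤ d) :
    (I ⊓ J).ideal d hd = I.ideal d hd ⊓ J.ideal d hd := rfl

@[simp] theorem ideal_top (d : C) (hd : c ≤ d) : (⊤ : IdealFamily L c).ideal d hd = ⊤ := rfl

@[simp] theorem ideal_bot (d : C) (hd : c ≤ d) : (⊥ : IdealFamily L c).ideal d hd = ⊥ := rfl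

/-- Restriction to a later stage. -/
def restrict {c' : C} (h : c ≤ c') : BoundedLatticeHom (IdealFamily L c) (IdealFamily L c') where
  toFun I :=
    { ideal := fun d hd => I.ideal d (h.trans hd)
      res_mem := fun hd k _ hx => I.res_mem (h.trans hd) k hx }
  map_sup' _ _ := rfl
  map_inf' _ _ := rfl
  map_top' := rfl
  map_bot' := rfl

/-- Direct image along a homomorphism of internal lattices. -/
def map (α : L ⟶ M) (c : C) : BoundedLatticeHom (IdealFamily L c) (IdealFamily M c) where
  toFun I :=
    { ideal := fun d hd => pushIdeal (α.app d).hom (I.ideal d hd)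
      res_mem := by
        rintro d e hd h x ⟨y, hy, hx⟩
        exact ⟨_, I.res_mem hd h hy,
          (OrderHomClass.mono (res M h) hx).trans (app_res α h y).ge⟩ }
  map_sup' I J := IdealFamily.ext (funext fun d => funext fun hd => pushIdeal_sup _ _ _)
  map_inf' I J := IdealFamily.ext (funext fun d => funext fun hd => pushIdeal_inf _ _ _)
  map_top' := IdealFamily.ext (funext fun d => funext fun hd => pushIdeal_top _)
  map_bot' := IdealFamily.ext (funext fun d => funext fun hd => pushIdeal_bot _)

@[simp] theorem mem_restrict {c' : C} (h : c ≤ c') (I : IdealFamily L c) (d : C) (hd : c' ≤ d)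
    (x : L.obj d) : x ∈ (restrict h I).ideal d hd ↔ x ∈ I.ideal d (h.trans hd) := Iff.rfl

@[simp] theorem mem_map (α : L ⟶ M) (I : IdealFamily L c) (d : C) (hd : c ≤ d) (y : M.obj d) :
    y ∈ (map α c I).ideal d hd ↔ ∃ x ∈ I.ideal d hd, y ≤ α.app d x := Iff.rfl

end IdealFamily

open IdealFamily in
/-- The internal ideal completion of an internal distributive lattice. -/
def idl (L : C ⥤ BddDistLat.{u}) : C ⥤ BddDistLat.{u} where
  obj c := BddDistLat.of (IdealFamily L c)
  map f := BddDistLat.ofHom (restrict (leOfHom f))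
  map_id _ := rfl
  map_comp _ _ := rfl

/-- The internal ideal completion as an endofunctor of the category of internal distributive
lattices. -/
def idlFunctor (C : Type u) [PartialOrder C] : (C ⥤ BddDistLat.{u}) ⥤ (C ⥤ BddDistLat.{u}) where
  obj L := idl L
  map α := { app := fun c => BddDistLat.ofHom (IdealFamily.map α c) }
  map_id L := by
    ext c I
    apply IdealFamily.ext_mem
    intro d hd x
    exact ⟨fun ⟨y, hy, hx⟩ => Order.Ideal.lower _ hx hy, fun hx => ⟨x, hx, le_rfl⟩⟩
  map_comp α β := by
    ext c I
    apply IdealFamily.ext_mem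
    intro d hd x
    constructor
    · rintro ⟨y, hy, hx⟩
      exact ⟨_, ⟨y, hy, le_rfl⟩, hx⟩
    · rintro ⟨y, ⟨z, hz, hy⟩, hx⟩
      exact ⟨z, hz, hx.trans (OrderHomClass.mono (β.app d).hom hy)⟩

/-- The unit of the ideal completion, sending an element to the principal ideal it generates. -/
def idlUnit (L : C ⥤ BddDistLat.{u}) : L ⟶ idl L where
  app c := BddDistLat.ofHom
    { toFun := fun x =>
        { ideal := fun d hd => Order.Ideal.principal (res L hd x)
          res_mem := by
            intro d e hd h y hy
            exact (OrderHomClass.mono (res L h) hy).trans (res_res L hd h x).le }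
      map_sup' := fun x y => by
        apply IdealFamily.ext_mem
        intro d hd z
        constructor
        · intro hz
          exact ⟨_, le_rfl, _, le_rfl, le_trans hz (map_sup _ _ _).le⟩
        · rintro ⟨i, hi, j, hj, hz⟩
          exact hz.trans ((sup_le_sup hi hj).trans (map_sup _ _ _).ge)
      map_inf' := fun x y => by
        apply IdealFamily.ext_mem
        intro d hd z
        constructor
        · intro hz
          have hz' := le_trans hz (map_inf (res L hd) x y).le
          exact ⟨hz'.trans inf_le_left, hz'.trans inf_le_right⟩
        · rintro ⟨h, h'⟩
          exact (le_inf h h').trans (map_inf (res L hd) x y).ge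
      map_top' := by
        apply IdealFamily.ext_mem
        intro d hd z
        exact ⟨fun _ => trivial, fun _ => le_top.trans (map_top (res L hd)).ge⟩
      map_bot' := by
        apply IdealFamily.ext_mem
        intro d hd z
        exact ⟨fun h => le_trans h (map_bot (res L hd)).le,
          fun h => le_trans h (map_bot (res L hd)).ge⟩ }
  naturality c d f := by
    ext x
    apply IdealFamily.ext_mem
    intro e he y
    change y ≤ res L he (res L (leOfHom f) x) ↔ y ≤ res L _ x
    rw [res_res]

theorem mem_idlUnit (L : C ⥤ BddDistLat.{u}) (c : C) (x : L.obj c) (d : C) (hd : c ≤ d)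
    (y : L.obj d) :
    y ∈ IdealFamily.ideal ((idlUnit L).app c x : IdealFamily L c) d hd ↔ y ≤ res L hd x := Iff.rfl

/-- The multiplication of the ideal completion, sending an ideal of ideals to its union. -/
def idlMul (L : C ⥤ BddDistLat.{u}) : idl (idl L) ⟶ idl L where
  app c := BddDistLat.ofHom
    { toFun := fun (J : IdealFamily (idl L) c) =>
        { ideal := fun d hd =>
            { carrier := {x | ∃ K : IdealFamily L d, K ∈ J.ideal d hd ∧ x ∈ K.ideal d le_rfl}
              lower' := fun _ _ hab ⟨K, hK, hx⟩ => ⟨K, hK, Order.Ideal.lower _ hab hx⟩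
              nonempty' := ⟨⊥, (⊥ : IdealFamily L d), Order.Ideal.bot_mem (P := IdealFamily L d) _,
                Order.Ideal.bot_mem _⟩
              directed' := fun x ⟨K, hK, hx⟩ y ⟨K', hK', hy⟩ =>
                ⟨x ⊔ y, ⟨K ⊔ K', Order.Ideal.sup_mem hK hK', ⟨x, hx, y, hy, le_rfl⟩⟩,
                  le_sup_left, le_sup_right⟩ }
          res_mem := fun {d e} hd h {x} ⟨K, hK, hx⟩ =>
            ⟨IdealFamily.restrict h K, J.res_mem hd h hK, K.res_mem le_rfl h hx⟩ }
      map_sup' := fun J J' => by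
        apply IdealFamily.ext_mem
        intro d hd x
        constructor
        · rintro ⟨K, ⟨I, hI, I', hI', hK⟩, hx⟩
          obtain ⟨i, hi, i', hi', hx'⟩ := hK d le_rfl hx
          exact ⟨i, ⟨I, hI, hi⟩, i', ⟨I', hI', hi'⟩, hx'⟩
        · rintro ⟨i, ⟨I, hI, hi⟩, i', ⟨I', hI', hi'⟩, hx⟩
          exact ⟨I ⊔ I', ⟨I, hI, I', hI', le_rfl⟩, ⟨i, hi, i', hi', hx⟩⟩
      map_inf' := fun J J' => by
        apply IdealFamily.ext_mem
        intro d hd x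
        constructor
        · rintro ⟨K, ⟨hK, hK'⟩, hx⟩
          exact ⟨⟨K, hK, hx⟩, ⟨K, hK', hx⟩⟩
        · rintro ⟨⟨K, hK, hx⟩, ⟨K', hK', hx'⟩⟩
          exact ⟨K ⊓ K', ⟨Order.Ideal.lower _ inf_le_left hK,
            Order.Ideal.lower _ inf_le_right hK'⟩, ⟨hx, hx'⟩⟩
      map_top' := by
        apply IdealFamily.ext_mem
        intro d hd x
        exact ⟨fun _ => trivial, fun _ => ⟨⊤, trivial, trivial⟩⟩
      map_bot' := by
        apply IdealFamily.ext_mem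
        intro d hd x
        constructor
        · rintro ⟨K, hK, hx⟩
          have hK' : K ≤ ⊥ := hK
          exact hK' d le_rfl hx
        · intro hx
          exact ⟨⊥, Order.Ideal.bot_mem (P := IdealFamily L d) _, hx⟩ }
  naturality c d f := by
    ext J
    rfl

theorem mem_idlMul (L : C ⥤ BddDistLat.{u}) (c : C) (J : IdealFamily (idl L) c) (d : C)
    (hd : c ≤ d) (x : L.obj d) :
    x ∈ IdealFamily.ideal ((idlMul L).app c J : IdealFamily L c) d hd ↔
      ∃ K : IdealFamily L d, K ∈ J.ideal d hd ∧ x ∈ K.ideal d le_rfl := Iff.rfl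

/-- The ideal completion monad on internal distributive lattices in the Kripke topos `Set^C`. -/
def idlMonad (C : Type u) [PartialOrder C] : Monad (C ⥤ BddDistLat.{u}) where
  toFunctor := idlFunctor C
  η :=
    { app := fun L => idlUnit L
      naturality := by
        intro L M α
        ext c x
        apply IdealFamily.ext_mem
        intro d hd y
        change y ≤ res M hd (α.app c x) ↔ ∃ z, z ≤ res L hd x ∧ y ≤ α.app d z
        rw [← app_res]
        exact ⟨fun h => ⟨_, le_rfl, h⟩,
          fun ⟨z, hz, hy⟩ => hy.trans (OrderHomClass.mono (α.app d).hom hz)⟩ }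
  μ :=
    { app := fun L => idlMul L
      naturality := by
        intro L M α
        ext c J
        apply IdealFamily.ext_mem
        intro d hd y
        constructor
        · rintro ⟨K, ⟨K', hK', hK⟩, hy⟩
          obtain ⟨z, hz, hyz⟩ := hK d le_rfl hy
          exact ⟨z, ⟨K', hK', hz⟩, hyz⟩
        · rintro ⟨z, ⟨K', hK', hz⟩, hyz⟩
          exact ⟨IdealFamily.map α d K', ⟨K', hK', le_rfl⟩, ⟨z, hz, hyz⟩⟩ }
  assoc L := by
    ext c J
    apply IdealFamily.ext_mem
    intro d hd x
    constructor
    · rintro ⟨K, ⟨J', hJ', hK⟩, hx⟩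
      obtain ⟨K', hK', hx'⟩ := hK d le_rfl hx
      exact ⟨K', ⟨J', hJ', hK'⟩, hx'⟩
    · rintro ⟨K', ⟨J', hJ', hK'⟩, hx'⟩
      exact ⟨(idlMul L).app d J', ⟨J', hJ', le_rfl⟩, ⟨K', hK', hx'⟩⟩
  left_unit L := by
    ext c I
    apply IdealFamily.ext_mem
    intro d hd x
    constructor
    · rintro ⟨K, hK, hx⟩
      exact hK d le_rfl hx
    · intro hx
      exact ⟨IdealFamily.restrict hd I, le_refl (IdealFamily.restrict hd I), hx⟩
  right_unit L := by
    ext c I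
    apply IdealFamily.ext_mem
    intro d hd x
    constructor
    · rintro ⟨K, ⟨y, hy, hK⟩, hx⟩
      have : x ≤ res L le_rfl y := hK d le_rfl hx
      rw [res_self] at this
      exact Order.Ideal.lower _ this hy
    · intro hx
      exact ⟨(idlUnit L).app d x, ⟨x, hx, le_rfl⟩, (res_self L le_rfl x).ge⟩

/-- The category of internal frames in the Kripke topos `Set^C`: the Eilenberg-Moore category of
the ideal completion monad. -/
abbrev InternalFrame (C : Type u) [PartialOrder C] := (idlMonad C).Algebra

end Kripke

section DirectImage

variable {C D E : Type u} [PartialOrder C] [PartialOrder D] [PartialOrder E]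

/-- An element at `d` of the direct image of `L` along `φ`, i.e. of the limit of `L` over
`{c | d ≤ φ c}`. -/
@[ext]
structure PushSection (φ : C →o D) (L : C ⥤ BddDistLat.{u}) (d : D) : Type u where
  val : ∀ c, d ≤ φ c → L.obj c
  res_val : ∀ {c c' : C} (hc : d ≤ φ c) (h : c ≤ c'),
    res L h (val c hc) = val c' (hc.trans (φ.monotone h))

namespace PushSection

variable {φ : C →o D} {L M : C ⥤ BddDistLat.{u}} {d : D}

instance : DistribLattice (PushSection φ L d) where
  le s t := ∀ c hc, s.val c hc ≤ t.val c hc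
  le_refl _ _ _ := le_rfl
  le_trans _ _ _ h k c hc := (h c hc).trans (k c hc)
  le_antisymm _ _ h k :=
    PushSection.ext (funext fun c => funext fun hc => le_antisymm (h c hc) (k c hc))
  sup s t :=
    { val := fun c hc => s.val c hc ⊔ t.val c hc
      res_val := fun hc h => by rw [map_sup, s.res_val, t.res_val] }
  inf s t :=
    { val := fun c hc => s.val c hc ⊓ t.val c hc
      res_val := fun hc h => by rw [map_inf, s.res_val, t.res_val] }
  le_sup_left _ _ _ _ := le_sup_left
  le_sup_right _ _ _ _ := le_sup_right
  sup_le _ _ _ h k c hc := sup_le (h c hc) (k c hc)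
  inf_le_left _ _ _ _ := inf_le_left
  inf_le_right _ _ _ _ := inf_le_right
  le_inf _ _ _ h k c hc := le_inf (h c hc) (k c hc)
  le_sup_inf _ _ _ _ _ := le_sup_inf

instance : BoundedOrder (PushSection φ L d) where
  top := { val := fun _ _ => ⊤, res_val := fun _ h => map_top (res L h) }
  le_top _ _ _ := le_top
  bot := { val := fun _ _ => ⊥, res_val := fun _ h => map_bot (res L h) }
  bot_le _ _ _ := bot_le

/-- Restriction to a later stage. -/
def restrict {d' : D} (h : d ≤ d') :
    BoundedLatticeHom (PushSection φ L d) (PushSection φ L d') where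
  toFun s :=
    { val := fun c hc => s.val c (h.trans hc)
      res_val := fun hc k => s.res_val (h.trans hc) k }
  map_sup' _ _ := rfl
  map_inf' _ _ := rfl
  map_top' := rfl
  map_bot' := rfl

/-- Functoriality in the internal lattice. -/
def map (α : L ⟶ M) (d : D) : BoundedLatticeHom (PushSection φ L d) (PushSection φ M d) where
  toFun s :=
    { val := fun c hc => α.app c (s.val c hc)
      res_val := fun hc h => by rw [← app_res, s.res_val] }
  map_sup' _ _ := PushSection.ext (funext fun c => funext fun _ => map_sup (α.app c).hom _ _)
  map_inf' _ _ := PushSection.ext (funext fun c => funext fun _ => map_inf (α.app c).hom _ _)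
  map_top' := PushSection.ext (funext fun c => funext fun _ => map_top (α.app c).hom)
  map_bot' := PushSection.ext (funext fun c => funext fun _ => map_bot (α.app c).hom)

/-- Evaluation at a point. -/
def evalAt (φ : C →o D) (L : C ⥤ BddDistLat.{u}) (d : D) (c : C) (hc : d ≤ φ c) :
    BoundedLatticeHom (PushSection φ L d) (L.obj c) where
  toFun s := s.val c hc
  map_sup' _ _ := rfl
  map_inf' _ _ := rfl
  map_top' := rfl
  map_bot' := rfl

end PushSection

/-- The inverse image functor `φ^*` on internal distributive lattices. -/
def inverseImage (φ : C →o D) : (D ⥤ BddDistLat.{u}) ⥤ (C ⥤ BddDistLat.{u}) :=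
  (Functor.whiskeringLeft _ _ _).obj φ.monotone.functor

/-- The direct image functor `φ_*` on internal distributive lattices. -/
def directImage (φ : C →o D) : (C ⥤ BddDistLat.{u}) ⥤ (D ⥤ BddDistLat.{u}) where
  obj L :=
    { obj := fun d => BddDistLat.of (PushSection φ L d)
      map := fun f => BddDistLat.ofHom (PushSection.restrict (leOfHom f))
      map_id := fun _ => rfl
      map_comp := fun _ _ => rfl }
  map α := { app := fun d => BddDistLat.ofHom (PushSection.map α d) }
  map_id _ := rfl
  map_comp _ _ := rfl

/-- The transpose `M ⟶ φ_* L` of a homomorphism `φ^* M ⟶ L`. -/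
def transpose (φ : C →o D) {L : C ⥤ BddDistLat.{u}} {M : D ⥤ BddDistLat.{u}}
    (α : (inverseImage φ).obj M ⟶ L) : M ⟶ (directImage φ).obj L where
  app d := BddDistLat.ofHom
    { toFun := fun x =>
        { val := fun c hc => α.app c (res M hc x)
          res_val := fun {c c'} hc h => by
            exact (app_res α h (res M hc x : M.obj (φ c))).symm.trans
              (congrArg (α.app c') (res_res M hc (φ.monotone h) x)) }
      map_sup' := fun x y => PushSection.ext (funext fun c => funext fun hc =>
        (congrArg (α.app c) ((res M hc).map_sup' x y)).trans ((α.app c).hom.map_sup' _ _))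
      map_inf' := fun x y => PushSection.ext (funext fun c => funext fun hc =>
        (congrArg (α.app c) ((res M hc).map_inf' x y)).trans ((α.app c).hom.map_inf' _ _))
      map_top' := PushSection.ext (funext fun c => funext fun hc =>
        (congrArg (α.app c) (map_top (res M hc))).trans (map_top (α.app c).hom))
      map_bot' := PushSection.ext (funext fun c => funext fun hc =>
        (congrArg (α.app c) (map_bot (res M hc))).trans (map_bot (α.app c).hom)) }
  naturality d d' f := by
    ext x
    refine PushSection.ext (funext fun c => funext fun hc => ?_)
    exact congrArg (α.app c) (res_res M (leOfHom f) hc x)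

/-- The inverse image functor is left adjoint to the direct image functor. -/
def imageAdjunction (φ : C →o D) : inverseImage φ ⊣ directImage φ :=
  Adjunction.mkOfHomEquiv
    { homEquiv := fun M L =>
        { toFun := fun α => transpose φ α
          invFun := fun β =>
            { app := fun c => β.app (φ c) ≫ BddDistLat.ofHom
                (PushSection.evalAt φ L (φ c) c le_rfl)
              naturality := fun c c' f => by
                ext x
                have h := app_res β (φ.monotone (leOfHom f)) x
                have h' := (β.app (φ c) x : PushSection φ L (φ c)).res_val le_rfl (leOfHom f)
                exact (congrArg (fun s : PushSection φ L (φ c') => s.val c' le_rfl) h).trans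
                  h'.symm }
          left_inv := fun α => by
            ext c x
            exact congrArg (α.app c) (res_self M le_rfl x)
          right_inv := fun β => by
            ext d x
            refine PushSection.ext (funext fun c => funext fun hc => ?_)
            exact congrArg (fun s : PushSection φ L (φ c) => s.val c le_rfl) (app_res β hc x) }
      homEquiv_naturality_left_symm := fun _ _ => rfl
      homEquiv_naturality_right := fun _ _ => rfl }

/-- The canonical morphism `Idl (φ_* L) ⟶ φ_* (Idl L)`. It is the direct image of ideals along the
counit `φ^* φ_* L ⟶ L`. -/
def idlDirect (φ : C →o D) (L : C ⥤ BddDistLat.{u}) :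
    (idlMonad D).obj ((directImage φ).obj L) ⟶ (directImage φ).obj ((idlMonad C).obj L) where
  app d := BddDistLat.ofHom
    { toFun := fun (J : IdealFamily ((directImage φ).obj L) d) =>
        { val := fun c hc => show IdealFamily L c from
            { ideal := fun e he => pushIdeal (PushSection.evalAt φ L (φ e) e le_rfl)
                (J.ideal (φ e) (hc.trans (φ.monotone he)))
              res_mem := by
                rintro e e' he h x ⟨s, hs, hx⟩
                refine ⟨_, J.res_mem (hc.trans (φ.monotone he)) (φ.monotone h) hs, ?_⟩
                exact (OrderHomClass.mono (res L h) hx).trans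
                  (PushSection.res_val s le_rfl h).le }
          res_val := fun _ _ => rfl }
      map_sup' := fun _ _ => PushSection.ext (funext fun _ => funext fun _ =>
        IdealFamily.ext (funext fun _ => funext fun _ => pushIdeal_sup _ _ _))
      map_inf' := fun _ _ => PushSection.ext (funext fun _ => funext fun _ =>
        IdealFamily.ext (funext fun _ => funext fun _ => pushIdeal_inf _ _ _))
      map_top' := PushSection.ext (funext fun _ => funext fun _ =>
        IdealFamily.ext (funext fun _ => funext fun _ => pushIdeal_top _))
      map_bot' := PushSection.ext (funext fun _ => funext fun _ =>
        IdealFamily.ext (funext fun _ => funext fun _ => pushIdeal_bot _)) }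
  naturality _ _ _ := rfl

theorem idlDirect_naturality (φ : C →o D) {L M : C ⥤ BddDistLat.{u}} (α : L ⟶ M) :
    (idlMonad D).map ((directImage φ).map α) ≫ idlDirect φ M =
      idlDirect φ L ≫ (directImage φ).map ((idlMonad C).map α) := by
  ext d J
  refine PushSection.ext (funext fun c => funext fun hc => IdealFamily.ext_mem fun e he y => ?_)
  constructor
  · rintro ⟨t, ⟨s, hs, ht⟩, hy⟩
    exact ⟨PushSection.val s e le_rfl, ⟨s, hs, le_rfl⟩, le_trans hy (ht e le_rfl)⟩
  · rintro ⟨x, ⟨s, hs, hx⟩, hy⟩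
    exact ⟨PushSection.map α _ s, ⟨s, hs, le_rfl⟩, hy.trans (OrderHomClass.mono (α.app e).hom hx)⟩

theorem idlDirect_unit (φ : C →o D) (L : C ⥤ BddDistLat.{u}) :
    (idlMonad D).η.app ((directImage φ).obj L) ≫ idlDirect φ L = (directImage φ).map ((idlMonad C).η.app L) := by
  ext d s
  refine PushSection.ext (funext fun c => funext fun hc => IdealFamily.ext_mem fun e he y => ?_)
  have h := PushSection.res_val s hc he
  constructor
  · rintro ⟨t, ht, hy⟩
    exact (le_trans hy (ht e le_rfl)).trans h.ge
  · intro hy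
    exact ⟨PushSection.restrict (hc.trans (φ.monotone he)) s,
      le_refl (PushSection.restrict (hc.trans (φ.monotone he)) s), le_trans hy h.le⟩

theorem idlDirect_mul (φ : C →o D) (L : C ⥤ BddDistLat.{u}) :
    (idlMonad D).μ.app ((directImage φ).obj L) ≫ idlDirect φ L =
      (idlMonad D).map (idlDirect φ L) ≫ idlDirect φ ((idlMonad C).obj L) ≫
        (directImage φ).map ((idlMonad C).μ.app L) := by
  ext d J
  refine PushSection.ext (funext fun c => funext fun hc => IdealFamily.ext_mem fun e he y => ?_)
  constructor
  · rintro ⟨s, ⟨K, hK, hs⟩, hy⟩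
    exact ⟨PushSection.val ((idlDirect φ L).app (φ e) K) e le_rfl,
      ⟨_, ⟨K, hK, le_rfl⟩, le_rfl⟩, ⟨s, hs, hy⟩⟩
  · rintro ⟨K', ⟨T, ⟨K, hK, hT⟩, hK'⟩, hy⟩
    obtain ⟨s, hs, hy'⟩ := (le_trans hK' (hT e le_rfl) : K' ≤ _) e le_rfl hy
    exact ⟨s, ⟨K, hK, hs⟩, hy'⟩

/-- The direct image functor on internal frames. -/
def directImageFrame (φ : C →o D) : InternalFrame C ⥤ InternalFrame D where
  obj A :=
    { A := (directImage φ).obj A.A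
      a := idlDirect φ A.A ≫ (directImage φ).map A.a
      unit := by
        rw [← Category.assoc, idlDirect_unit, ← Functor.map_comp, A.unit]
        exact (directImage φ).map_id A.A
      assoc := by
        rw [← Category.assoc, idlDirect_mul, Category.assoc, Category.assoc, ← Functor.map_comp,
          A.assoc, Functor.map_comp, Functor.map_comp, Category.assoc,
          ← Category.assoc ((idlMonad D).map ((directImage φ).map A.a)), idlDirect_naturality,
          Category.assoc] }
  map {A B} f :=
    { f := (directImage φ).map f.f
      h := by
        change (idlMonad D).map ((directImage φ).map f.f) ≫ idlDirect φ B.A ≫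
          (directImage φ).map B.a = (idlDirect φ A.A ≫ (directImage φ).map A.a) ≫
            (directImage φ).map f.f
        rw [← Category.assoc, idlDirect_naturality, Category.assoc, ← Functor.map_comp, f.h,
          Functor.map_comp, Category.assoc] }
  map_id A := by
    ext1
    exact (directImage φ).map_id A.A
  map_comp f g := by
    ext1
    exact (directImage φ).map_comp f.f g.f

/-- The internal frame homomorphism `Idl (φ_* L) ⟶ φ_* (Idl L)` between (direct images of) free
internal frames. -/
def idlDirectFrame (φ : C →o D) (L : C ⥤ BddDistLat.{u}) :
    (idlMonad D).free.obj ((directImage φ).obj L) ⟶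
      (directImageFrame φ).obj ((idlMonad C).free.obj L) where
  f := idlDirect φ L
  h := (idlDirect_mul φ L).symm

/-- The canonical comparison `ψ_* φ_* L ⟶ (ψ ∘ φ)_* L`. -/
def pushComp (φ : C →o D) (ψ : D →o E) (L : C ⥤ BddDistLat.{u}) :
    (directImage ψ).obj ((directImage φ).obj L) ⟶ (directImage (ψ.comp φ)).obj L where
  app e := BddDistLat.ofHom
    { toFun := fun (s : PushSection ψ ((directImage φ).obj L) e) =>
        { val := fun c hc => PushSection.val (s.val (φ c) hc) c le_rfl
          res_val := fun {c c'} hc h =>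
            (PushSection.res_val (s.val (φ c) hc) le_rfl h).trans
              (congrArg (fun t : PushSection φ L (φ c') => t.val c' le_rfl)
                (s.res_val hc (φ.monotone h))) }
      map_sup' := fun _ _ => rfl
      map_inf' := fun _ _ => rfl
      map_top' := rfl
      map_bot' := rfl }
  naturality _ _ _ := rfl

/-- The canonical comparison `L ⟶ id_* L`. -/
def pushId (L : C ⥤ BddDistLat.{u}) : L ⟶ (directImage OrderHom.id).obj L :=
  transpose OrderHom.id (𝟙 L)

/-- The comparison `ψ_* φ_* A ⟶ (ψ ∘ φ)_* A` for internal frames. -/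
def pushCompFrame (φ : C →o D) (ψ : D →o E) (A : InternalFrame C) :
    (directImageFrame ψ).obj ((directImageFrame φ).obj A) ⟶
      (directImageFrame (ψ.comp φ)).obj A where
  f := pushComp φ ψ A.A
  h := by
    ext e J
    refine PushSection.ext (funext fun c => funext fun hc => ?_)
    refine congrArg (A.a.app c) (IdealFamily.ext_mem fun c' h y => ?_)
    constructor
    · rintro ⟨s, ⟨t, ht, hs⟩, hy⟩
      exact ⟨PushSection.val t (φ c') le_rfl, ⟨t, ht, le_rfl⟩, le_trans hy (hs c' le_rfl)⟩
    · rintro ⟨s, ⟨t, ht, hs⟩, hy⟩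
      exact ⟨(pushComp φ ψ A.A).app _ t, ⟨t, ht, le_rfl⟩, le_trans hy (hs c' le_rfl)⟩

/-- The comparison `A ⟶ id_* A` for internal frames. -/
def pushIdFrame (A : InternalFrame C) : A ⟶ (directImageFrame OrderHom.id).obj A where
  f := pushId A.A
  h := by
    ext d J
    refine PushSection.ext (funext fun c => funext fun hc => ?_)
    refine Eq.trans ?_ (app_res A.a hc J)
    refine congrArg (A.a.app c) (IdealFamily.ext_mem fun e h y => ?_)
    constructor
    · rintro ⟨s, ⟨t, ht, hs⟩, hy⟩
      have := le_trans hy ((hs e le_rfl).trans (res_self A.A le_rfl t).le)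
      exact Order.Ideal.lower _ this ht
    · intro hy
      exact ⟨(pushId A.A).app e y, ⟨y, hy, le_rfl⟩, (res_self A.A le_rfl y).ge⟩

end DirectImage

section Omega

variable {C : Type u} [PartialOrder C]

/-- The value at `c` of the subobject classifier of `Set^C`: upper subsets of `{d | c ≤ d}`. -/
@[ext]
structure Truth (c : C) : Type u where
  carrier : Set C
  upper : IsUpperSet carrier
  above : ∀ {d}, d ∈ carrier → c ≤ d

namespace Truth

instance (c : C) : DistribLattice (Truth c) where
  le U V := U.carrier ⊆ V.carrier
  le_refl U := subset_refl U.carrier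
  le_trans _ _ _ h k := subset_trans h k
  le_antisymm _ _ h k := Truth.ext (subset_antisymm h k)
  sup U V := ⟨U.carrier ∪ V.carrier, U.upper.union V.upper, fun h => h.elim U.above V.above⟩
  inf U V := ⟨U.carrier ∩ V.carrier, U.upper.inter V.upper, fun h => U.above h.1⟩
  le_sup_left _ _ := Set.subset_union_left
  le_sup_right _ _ := Set.subset_union_right
  sup_le _ _ _ h k := Set.union_subset h k
  inf_le_left _ _ := Set.inter_subset_left
  inf_le_right _ _ := Set.inter_subset_right
  le_inf _ _ _ h k := Set.subset_inter h k
  le_sup_inf U V W := (Set.union_inter_distrib_left U.carrier V.carrier W.carrier).ge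

instance (c : C) : BoundedOrder (Truth c) where
  top := ⟨Set.Ici c, isUpperSet_Ici c, fun h => h⟩
  le_top U _ h := U.above h
  bot := ⟨∅, isUpperSet_empty, fun h => h.elim⟩
  bot_le U := Set.empty_subset U.carrier

/-- Restriction to a later stage. -/
def restrict {c c' : C} (h : c ≤ c') : BoundedLatticeHom (Truth c) (Truth c') where
  toFun U := ⟨U.carrier ∩ Set.Ici c', U.upper.inter (isUpperSet_Ici c'), fun h => h.2⟩
  map_sup' _ _ := Truth.ext (Set.union_inter_distrib_right _ _ _)
  map_inf' _ _ := Truth.ext (Set.inter_inter_distrib_right _ _ _)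
  map_top' := Truth.ext (Set.inter_eq_right.mpr fun _ hd => h.trans hd)
  map_bot' := Truth.ext (Set.empty_inter _)

end Truth

/-- The subobject classifier as an internal distributive lattice. -/
def truthLattice (C : Type u) [PartialOrder C] : C ⥤ BddDistLat.{u} where
  obj c := BddDistLat.of (Truth c)
  map f := BddDistLat.ofHom (Truth.restrict (leOfHom f))
  map_id _ := BddDistLat.ext fun U => Truth.ext
    (Set.inter_eq_left.mpr fun _ hd => Truth.above U hd)
  map_comp _ g := BddDistLat.ext fun _ => Truth.ext (Set.ext fun _ =>
    ⟨fun h => ⟨⟨h.1, (leOfHom g).trans h.2⟩, h.2⟩, fun h => ⟨h.1.1, h.2⟩⟩)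

/-- The family of ideals `d ↦ {x | x = ⊥ or d ∈ U}` of an internal distributive lattice associated
with a truth value `U`. -/
def truthIdeal (L : C ⥤ BddDistLat.{u}) : truthLattice C ⟶ (idlMonad C).obj L where
  app c := BddDistLat.ofHom
    { toFun := fun (U : Truth c) => show IdealFamily L c from
        { ideal := fun d _ =>
            { carrier := {x | x = ⊥ ∨ d ∈ U.carrier}
              lower' := fun _ _ hxy hx => hx.imp (fun h : _ = ⊥ => le_bot_iff.mp (hxy.trans h.le)) id
              nonempty' := ⟨⊥, Or.inl rfl⟩
              directed' := fun x hx y hy => by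
                rcases hx with hx | hx
                · exact ⟨y, hy, hx ▸ bot_le, le_rfl⟩
                · exact ⟨x ⊔ y, Or.inr hx, le_sup_left, le_sup_right⟩ }
          res_mem := fun _ h _ hx =>
            hx.imp (fun hx => by rw [hx, map_bot]) (fun hx => U.upper h hx) }
      map_sup' := fun U V => IdealFamily.ext_mem fun d hd x => by
        constructor
        · rintro (hx | hx | hx)
          · rw [hx]; exact Order.Ideal.bot_mem _
          · exact ⟨x, Or.inr hx, ⊥, Or.inl rfl, le_sup_left⟩
          · exact ⟨⊥, Or.inl rfl, x, Or.inr hx, le_sup_right⟩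
        · rintro ⟨i, hi | hi, j, hj | hj, hx⟩
          · left
            rw [hi, hj, sup_bot_eq] at hx
            exact le_bot_iff.mp hx
          · exact Or.inr (Or.inr hj)
          · exact Or.inr (Or.inl hi)
          · exact Or.inr (Or.inl hi)
      map_inf' := fun U V => IdealFamily.ext_mem fun d hd x => by
        constructor
        · rintro (hx | hx)
          · exact ⟨Or.inl hx, Or.inl hx⟩
          · exact ⟨Or.inr hx.1, Or.inr hx.2⟩
        · rintro ⟨hx | hx, hx' | hx'⟩
          · exact Or.inl hx
          · exact Or.inl hx
          · exact Or.inl hx'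
          · exact Or.inr ⟨hx, hx'⟩
      map_top' := IdealFamily.ext_mem fun d hd x => ⟨fun _ => trivial, fun _ => Or.inr hd⟩
      map_bot' := IdealFamily.ext_mem fun d hd x =>
        ⟨fun h => h.elim (fun h => h.le) (fun h => h.elim), fun h => Or.inl (le_bot_iff.mp h)⟩ }
  naturality c c' f := by
    ext U
    exact IdealFamily.ext_mem fun d hd x => or_congr_right ⟨fun h => h.1, fun h => ⟨h, hd⟩⟩

theorem truthIdeal_naturality {L M : C ⥤ BddDistLat.{u}} (α : L ⟶ M) :
    truthIdeal L ≫ (idlMonad C).map α = truthIdeal M := by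
  ext c U
  refine IdealFamily.ext_mem fun d hd y => ?_
  constructor
  · rintro ⟨x, hx | hx, hy⟩
    · left
      rw [hx] at hy
      exact le_bot_iff.mp (hy.trans (map_bot (α.app d).hom).le)
    · exact Or.inr hx
  · rintro (hy | hy)
    · exact ⟨⊥, Or.inl rfl, hy ▸ bot_le⟩
    · exact ⟨⊤, Or.inr hy, le_top.trans (map_top (α.app d).hom).ge⟩

/-- The union of an ideal of truth values. -/
def truthUnion (C : Type u) [PartialOrder C] :
    (idlMonad C).obj (truthLattice C) ⟶ truthLattice C where
  app c := BddDistLat.ofHom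
    { toFun := fun (J : IdealFamily (truthLattice C) c) => show Truth c from
        { carrier := {d | ∃ h : c ≤ d, ∃ U : Truth d, U ∈ J.ideal d h ∧ d ∈ U.carrier}
          upper := fun d e hde ⟨h, U, hU, hd⟩ =>
            ⟨h.trans hde, Truth.restrict hde U, J.res_mem h hde hU, U.upper hde hd, le_refl e⟩
          above := fun ⟨h, _⟩ => h }
      map_sup' := fun I J => Truth.ext (Set.ext fun d => by
        constructor
        · rintro ⟨h, U, ⟨V, hV, W, hW, hU⟩, hd⟩
          exact (hU hd).imp (fun hd => ⟨h, V, hV, hd⟩) (fun hd => ⟨h, W, hW, hd⟩)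
        · rintro (⟨h, U, hU, hd⟩ | ⟨h, U, hU, hd⟩)
          · exact ⟨h, U, (le_sup_left : I.ideal d h ≤ _) hU, hd⟩
          · exact ⟨h, U, (le_sup_right : J.ideal d h ≤ _) hU, hd⟩)
      map_inf' := fun I J => Truth.ext (Set.ext fun d => by
        constructor
        · rintro ⟨h, U, hU, hd⟩
          exact ⟨⟨h, U, hU.1, hd⟩, ⟨h, U, hU.2, hd⟩⟩
        · rintro ⟨⟨h, U, hU, hd⟩, ⟨_, V, hV, hd'⟩⟩
          exact ⟨h, U ⊓ V, ⟨Order.Ideal.lower _ (inf_le_left : U ⊓ V ≤ U) hU,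
            Order.Ideal.lower _ (inf_le_right : U ⊓ V ≤ V) hV⟩, ⟨hd, hd'⟩⟩)
      map_top' := Truth.ext (Set.ext fun d =>
        ⟨fun h => h.1, fun h => ⟨h, (⊤ : Truth d), trivial, le_refl d⟩⟩)
      map_bot' := Truth.ext (Set.ext fun d =>
        ⟨fun ⟨_, _, hU, hd⟩ => hU hd, fun h => h.elim⟩) }
  naturality c c' f := by
    ext J
    exact Truth.ext (Set.ext fun d =>
      ⟨fun ⟨h, U, hU, hd⟩ => ⟨⟨(leOfHom f).trans h, U, hU, hd⟩, h⟩,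
        fun ⟨⟨_, U, hU, hd⟩, h⟩ => ⟨h, U, hU, hd⟩⟩)

theorem truthIdeal_union : truthIdeal (truthLattice C) ≫ truthUnion C = 𝟙 _ := by
  ext c U
  refine Truth.ext (Set.ext fun d => ?_)
  constructor
  · rintro ⟨h, V, hV | hV, hd⟩
    · rw [hV] at hd
      exact hd.elim
    · exact hV
  · intro hd
    exact ⟨Truth.above U hd, (⊤ : Truth d), Or.inr hd, le_refl d⟩

theorem truthUnion_ideal (L : C ⥤ BddDistLat.{u}) :
    (idlMonad C).map (truthIdeal L) ≫ (idlMonad C).μ.app L = truthUnion C ≫ truthIdeal L := by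
  ext c J
  refine IdealFamily.ext_mem fun d hd x => ?_
  constructor
  · rintro ⟨K, ⟨U, hU, hK⟩, hx⟩
    exact (hK d le_rfl hx : x = ⊥ ∨ d ∈ Truth.carrier U).imp_right fun h => ⟨hd, U, hU, h⟩
  · rintro (hx | ⟨h, U, hU, hd'⟩)
    · exact ⟨⊥, Order.Ideal.bot_mem (P := IdealFamily L d) _,
        by rw [hx]; exact Order.Ideal.bot_mem _⟩
    · exact ⟨_, ⟨U, hU, le_rfl⟩, Or.inr hd'⟩

/-- The subobject classifier `Ω` as an internal frame. -/
def truth (C : Type u) [PartialOrder C] : InternalFrame C where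
  A := truthLattice C
  a := truthUnion C
  unit := by
    ext c U
    refine Truth.ext (Set.ext fun d => ?_)
    constructor
    · rintro ⟨h, V, hV, hd⟩
      exact (hV hd).1
    · intro hd
      exact ⟨Truth.above U hd, Truth.restrict (Truth.above U hd) U,
        le_refl (Truth.restrict (Truth.above U hd) U), hd, le_refl d⟩
  assoc := by
    ext c J
    refine Truth.ext (Set.ext fun d => ?_)
    constructor
    · rintro ⟨h, U, ⟨K, hK, hU⟩, hd⟩
      exact ⟨h, (truthUnion C).app d K, ⟨K, hK, le_rfl⟩, ⟨le_refl d, U, hU, hd⟩⟩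
    · rintro ⟨h, U, ⟨K, hK, hU⟩, hd⟩
      obtain ⟨_, V, hV, hd'⟩ := hU hd
      exact ⟨h, V, ⟨K, hK, hV⟩, hd'⟩

/-- The unique internal frame homomorphism out of `Ω`. -/
def fromTruth (A : InternalFrame C) : truth C ⟶ A where
  f := truthIdeal A.A ≫ A.a
  h := by
    change (idlMonad C).map (truthIdeal A.A ≫ A.a) ≫ A.a = truthUnion C ≫ truthIdeal A.A ≫ A.a
    rw [Functor.map_comp, Category.assoc, ← A.assoc, ← Category.assoc, truthUnion_ideal,
      Category.assoc]

/-- `Ω` is the initial internal frame. -/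
def truthIsInitial (C : Type u) [PartialOrder C] : Limits.IsInitial (truth C) :=
  Limits.IsInitial.ofUniqueHom fromTruth fun A g => by
    have h : truthIdeal (truthLattice C) ≫ (idlMonad C).map g.f ≫ A.a =
        truthIdeal (truthLattice C) ≫ truthUnion C ≫ g.f :=
      congrArg (truthIdeal (truthLattice C) ≫ ·) g.h
    have h' : truthIdeal (truthLattice C) ≫ truthUnion C ≫ g.f = g.f :=
      congrArg (fun k : truthLattice C ⟶ truthLattice C => k ≫ g.f) truthIdeal_union
    have h'' : truthIdeal A.A ≫ A.a = truthIdeal (truthLattice C) ≫ (idlMonad C).map g.f ≫ A.a :=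
      congrArg (fun k : truthLattice C ⟶ (idlMonad C).obj A.A => k ≫ A.a)
        (truthIdeal_naturality g.f).symm
    exact Monad.Algebra.Hom.ext (h'.symm.trans (h.symm.trans h''.symm))

end Omega

/-! ### Global sections

Over the one-point poset, internal frames are frames. -/

section Point

/-- An ideal, as an ideal over the one-point poset. -/
def pointIdeal {L : PUnit.{u + 1} ⥤ BddDistLat.{u}} (I : Order.Ideal (L.obj PUnit.unit)) :
    IdealFamily L PUnit.unit where
  ideal _ _ := I
  res_mem := fun _ h x hx => (res_self L h x).symm ▸ hx

/-- The ideal generated by a subset. -/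
def genIdeal {P : Type u} [DistribLattice P] [BoundedOrder P] (S : Set P) : Order.Ideal P :=
  sInf {I | S ⊆ I}

theorem subset_genIdeal {P : Type u} [DistribLattice P] [BoundedOrder P] {S : Set P} {x : P}
    (hx : x ∈ S) : x ∈ genIdeal S :=
  Order.Ideal.mem_sInf.mpr fun _ hI => hI hx

theorem genIdeal_le {P : Type u} [DistribLattice P] [BoundedOrder P] {S : Set P}
    {I : Order.Ideal P} (h : S ⊆ I) : genIdeal S ≤ I :=
  sInf_le h

variable (A : InternalFrame PUnit.{u + 1})

/-- The join of an ideal in an internal frame over the point. -/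
def idealJoin (I : Order.Ideal (A.A.obj PUnit.unit)) : A.A.obj PUnit.unit :=
  A.a.app PUnit.unit (pointIdeal I : IdealFamily A.A PUnit.unit)

theorem idealJoin_mono {I J : Order.Ideal (A.A.obj PUnit.unit)} (h : I ≤ J) :
    idealJoin A I ≤ idealJoin A J :=
  OrderHomClass.mono (A.a.app PUnit.unit).hom
    (show (pointIdeal I : IdealFamily A.A PUnit.unit) ≤ pointIdeal J from fun _ _ => h)

theorem idealJoin_principal (x : A.A.obj PUnit.unit) :
    idealJoin A (Order.Ideal.principal x) = x := by
  have h := ConcreteCategory.congr_hom (NatTrans.congr_app A.unit PUnit.unit) x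
  refine Eq.trans ?_ h
  refine congrArg (A.a.app PUnit.unit) (IdealFamily.ext_mem fun d hd y => ?_)
  exact (show y ≤ x ↔ y ≤ res A.A hd x by rw [res_self])

theorem idealJoin_inf (I J : Order.Ideal (A.A.obj PUnit.unit)) :
    idealJoin A (I ⊓ J) = idealJoin A I ⊓ idealJoin A J :=
  (A.a.app PUnit.unit).hom.map_inf' (pointIdeal I : IdealFamily A.A PUnit.unit) (pointIdeal J)

theorem isLUB_idealJoin (S : Set (A.A.obj PUnit.unit)) : IsLUB S (idealJoin A (genIdeal S)) := by
  constructor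
  · intro x hx
    rw [← idealJoin_principal A x]
    exact idealJoin_mono A (Order.Ideal.principal_le_iff.mpr (subset_genIdeal hx))
  · intro y hy
    rw [← idealJoin_principal A y]
    exact idealJoin_mono A (genIdeal_le hy)

/-- The frame structure on an internal frame over the point: joins are computed by the structure
map of the algebra. -/
@[reducible]
def pointFrame : Order.Frame (A.A.obj PUnit.unit) :=
  let _ : CompleteLattice (A.A.obj PUnit.unit) :=
    { (inferInstance : Lattice (A.A.obj PUnit.unit)),
      (inferInstance : BoundedOrder (A.A.obj PUnit.unit)) with
      sSup := fun S => idealJoin A (genIdeal S)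
      isLUB_sSup := isLUB_idealJoin A
      sInf := fun S => idealJoin A (genIdeal (lowerBounds S))
      isGLB_sInf := fun S => isLUB_lowerBounds.mp (isLUB_idealJoin A (lowerBounds S)) }
  Order.Frame.ofMinimalAxioms
    { inf_sSup_le_iSup_inf := fun a S => by
        set m := ⨆ b ∈ S, a ⊓ b
        have h : genIdeal S ⊓ Order.Ideal.principal a ≤ Order.Ideal.principal m := by
          rintro x ⟨hx, hxa⟩
          have hle : genIdeal S ≤
              { carrier := {y | a ⊓ y ≤ m}
                lower' := fun y z hzy hy => (inf_le_inf_left a hzy).trans hy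
                nonempty' := ⟨⊥, by simp⟩
                directed' := fun y hy z hz => ⟨y ⊔ z, by
                  change a ⊓ (y ⊔ z) ≤ m
                  rw [inf_sup_left]
                  exact sup_le hy hz, le_sup_left, le_sup_right⟩ } :=
            genIdeal_le fun b hb => le_iSup₂_of_le b hb le_rfl
          exact (le_inf hxa le_rfl).trans (hle hx)
        have h' := idealJoin_mono A h
        rw [idealJoin_inf, idealJoin_principal, idealJoin_principal, inf_comm] at h'
        exact h' }

variable {A} in
theorem idealJoin_map {B : InternalFrame PUnit.{u + 1}} (f : A ⟶ B)
    (I : Order.Ideal (A.A.obj PUnit.unit)) :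
    f.f.app PUnit.unit (idealJoin A I) = idealJoin B (pushIdeal (f.f.app PUnit.unit).hom I) :=
  (ConcreteCategory.congr_hom (NatTrans.congr_app f.h PUnit.unit)
    (pointIdeal I : IdealFamily A.A PUnit.unit)).symm

variable {A} in
theorem isLUB_image {B : InternalFrame PUnit.{u + 1}} (f : A ⟶ B)
    (S : Set (A.A.obj PUnit.unit)) :
    IsLUB (f.f.app PUnit.unit '' S) (f.f.app PUnit.unit (idealJoin A (genIdeal S))) := by
  constructor
  · rintro _ ⟨x, hx, rfl⟩
    exact OrderHomClass.mono (f.f.app PUnit.unit).hom ((isLUB_idealJoin A S).1 hx)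
  · intro y hy
    rw [idealJoin_map, ← idealJoin_principal B y]
    refine idealJoin_mono B ?_
    rintro z ⟨x, hx, hz⟩
    have hle : genIdeal S ≤
        { carrier := {x | f.f.app PUnit.unit x ≤ y}
          lower' := fun x x' h hx => (OrderHomClass.mono (f.f.app PUnit.unit).hom h).trans hx
          nonempty' := ⟨⊥, (map_bot (f.f.app PUnit.unit).hom).le.trans bot_le⟩
          directed' := fun x hx x' hx' => ⟨x ⊔ x',
            (map_sup (f.f.app PUnit.unit).hom x x').le.trans (sup_le hx hx'),
            le_sup_left, le_sup_right⟩ } :=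
      genIdeal_le fun b hb => hy ⟨b, hb, rfl⟩
    exact hz.trans (hle hx)

/-- Internal frames over the point, as frames. -/
def pointFrm : InternalFrame PUnit.{u + 1} ⥤ Frm.{u} where
  obj A := @Frm.of (A.A.obj PUnit.unit) (pointFrame A)
  map {A B} f :=
    let _ := pointFrame A
    let _ := pointFrame B
    Frm.ofHom
      { toFun := fun x => f.f.app PUnit.unit x
        map_inf' := fun x y => map_inf (f.f.app PUnit.unit).hom x y
        map_top' := map_top (f.f.app PUnit.unit).hom
        map_sSup' := fun S => (isLUB_image f S).sSup_eq.symm }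
  map_id _ := rfl
  map_comp _ _ := rfl

end Point

/-- The unique monotone map to the one-point poset. -/
def toPoint (C : Type u) [PartialOrder C] : C →o PUnit.{u + 1} where
  toFun _ := PUnit.unit
  monotone' _ _ _ := le_rfl

/-- The direct image `f_*` to `Set` of internal frames of `Set^C`. -/
def globalSections (C : Type u) [PartialOrder C] : InternalFrame C ⥤ Frm.{u} :=
  directImageFrame (toPoint C) ⋙ pointFrm

/-! ### Framed topoi -/

/-- A Kripke topos `Set^C` together with an internal frame. -/
structure FramedTopos : Type (u + 1) where
  ctx : Type u
  [order : PartialOrder ctx]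
  frame : InternalFrame ctx

attribute [instance] FramedTopos.order

namespace FramedTopos

/-- A morphism `(Set^C, A) ⟶ (Set^D, B)` is a geometric morphism `Set^C → Set^D`, given by a
monotone map `φ : C → D`, and a homomorphism of internal frames `B ⟶ φ_* A`, i.e. the transpose of a
homomorphism `φ^♯ B ⟶ A` for the left adjoint `φ^♯` of `φ_*` on internal frames. -/
structure Hom (X Y : FramedTopos.{u}) : Type u where
  map : X.ctx →o Y.ctx
  comap : Y.frame ⟶ (directImageFrame map).obj X.frame

/-- The element of `X.frame` at `c` obtained from an element of `Y.frame` at `d ≤ φ c`. -/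
def Hom.comapAt {X Y : FramedTopos.{u}} (f : Hom X Y) {d : Y.ctx} (x : Y.frame.A.obj d) (c : X.ctx)
    (hc : d ≤ f.map c) : X.frame.A.obj c :=
  PushSection.val (f.comap.f.app d x) c hc

theorem Hom.ext_at {X Y : FramedTopos.{u}} {f g : Hom X Y} (h : f.map = g.map)
    (h' : ∀ d (x : Y.frame.A.obj d) c (hc : d ≤ f.map c),
      f.comapAt x c hc = g.comapAt x c (h ▸ hc)) : f = g := by
  obtain ⟨φ, a⟩ := f
  obtain ⟨ψ, b⟩ := g
  obtain rfl : φ = ψ := h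
  congr 1
  refine Monad.Algebra.Hom.ext ?_
  ext d x
  exact PushSection.ext (funext fun c => funext fun hc => h' d x c hc)

instance : Category FramedTopos.{u} where
  Hom := Hom
  id X := ⟨OrderHom.id, pushIdFrame X.frame⟩
  comp {X Y Z} f g := ⟨g.map.comp f.map,
    g.comap ≫ (directImageFrame g.map).map f.comap ≫ pushCompFrame f.map g.map X.frame⟩
  id_comp {X Y} f := Hom.ext_at rfl fun d x c hc => res_self X.frame.A le_rfl _
  comp_id {X Y} f := Hom.ext_at rfl fun d x c hc => by
    have h := app_res f.comap.f hc x
    exact congrArg (fun s : PushSection f.map X.frame.A (f.map c) => s.val c le_rfl) h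
  assoc _ _ _ := Hom.ext_at rfl fun _ _ _ _ => rfl

/-- The direct image to `Set`, as a functor to locales. -/
def toLocale : FramedTopos.{u} ⥤ Locale.{u} where
  obj X := op ((globalSections X.ctx).obj X.frame)
  map {X Y} f := Quiver.Hom.op
    (pointFrm.map ((directImageFrame (toPoint Y.ctx)).map f.comap ≫
      pushCompFrame f.map (toPoint Y.ctx) X.frame))
  map_id X := by
    refine congrArg Quiver.Hom.op (Frm.ext fun s => ?_)
    exact PushSection.ext (funext fun c => funext fun hc => res_self X.frame.A le_rfl _)
  map_comp _ _ := rfl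

/-- The underlying Kripke topos, with its subobject classifier as the internal frame. -/
def base : FramedTopos.{u} ⥤ FramedTopos.{u} where
  obj X := ⟨X.ctx, truth X.ctx⟩
  map {_ Y} f := ⟨f.map, (truthIsInitial Y.ctx).to _⟩
  map_id _ := congrArg (Hom.mk _) ((truthIsInitial _).hom_ext _ _)
  map_comp _ _ := congrArg (Hom.mk _) ((truthIsInitial _).hom_ext _ _)

/-- The morphism given by the identity geometric morphism and the unique frame homomorphism out of
the subobject classifier. -/
def toBase : 𝟭 FramedTopos.{u} ⟶ base where
  app X := ⟨OrderHom.id, (truthIsInitial X.ctx).to _⟩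
  naturality X Y f := congrArg (Hom.mk (X := X) (Y := base.obj Y) f.map)
    ((truthIsInitial Y.ctx).hom_ext _ _)

/-- The functor sending `(ℰ, F)` to the morphism of locales given by the frame homomorphism
`f_* Ω ⟶ f_* F`, where `f : ℰ → Set`. -/
def toArrow : FramedTopos.{u} ⥤ Arrow Locale.{u} where
  obj X := Arrow.mk (toLocale.map (toBase.app X))
  map f := Arrow.homMk (toLocale.map f) (toLocale.map (base.map f)) (by
    dsimp
    rw [← Functor.map_comp, ← Functor.map_comp]
    exact congrArg (fun g => toLocale.map g) (toBase.naturality f))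
  map_id X := by
    ext
    · exact toLocale.map_id X
    · exact (congrArg (fun h => toLocale.map h) (base.map_id X)).trans
        (toLocale.map_id (base.obj X))
  map_comp f g := by
    ext
    · exact toLocale.map_comp f g
    · exact (congrArg (fun h => toLocale.map h) (base.map_comp f g)).trans
        (toLocale.map_comp (base.map f) (base.map g))

end FramedTopos

/-! ### Box worlds -/

/-- A box presentation: a map `S → I` of finite sets. -/
structure Box : Type (u + 1) where
  quest : Type u
  party : Type u
  [finite_quest : Finite quest]
  [finite_party : Finite party]
  proj : quest → party

namespace Box

/-- A morphism of box presentations: a commutative square whose upper map is injective on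
fibres. -/
@[ext]
structure Hom (S' S : Box.{u}) : Type u where
  map : S'.quest → S.quest
  base : S'.party → S.party
  comm : ∀ s, S.proj (map s) = base (S'.proj s)
  inj : ∀ i, Set.InjOn map {s | S'.proj s = i}

instance : Category Box.{u} where
  Hom := Hom
  id S := ⟨id, id, fun _ => rfl, fun _ _ _ _ _ h => h⟩
  comp f g :=
    { map := g.map ∘ f.map
      base := g.base ∘ f.base
      comm := fun s => (g.comm (f.map s)).trans (congrArg g.base (f.comm s))
      inj := fun i s hs t ht h => f.inj i hs ht (g.inj (f.base i)
        ((f.comm s).trans (congrArg f.base hs)) ((f.comm t).trans (congrArg f.base ht)) h) }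

/-- A context: a subset of `S` on which the projection to `I` is injective. -/
def Context (S : Box.{u}) : Type u := {c : Set S.quest // Set.InjOn S.proj c}

instance (S : Box.{u}) : PartialOrder S.Context :=
  inferInstanceAs (PartialOrder {c : Set S.quest // Set.InjOn S.proj c})

/-- The map on contexts induced by a morphism: inverse image. -/
def contextMap {S' S : Box.{u}} (f : S' ⟶ S) : S.Context →o S'.Context where
  toFun c := ⟨f.map ⁻¹' c.1, fun s hs t ht h => f.inj (S'.proj t) h rfl
    (c.2 hs ht ((f.comm s).trans ((congrArg f.base h).trans (f.comm t).symm)))⟩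
  monotone' _ _ h := Set.preimage_mono h

/-- The inclusion of the poset of contexts in the category of sets. -/
def contextSets (S : Box.{u}) : S.Context ⥤ Type u where
  obj c := c.1
  map h := TypeCat.ofHom (Set.inclusion (leOfHom h))

/-- The internal Boolean algebra `L_{S/I}`, viewed as an internal distributive lattice. -/
def logic (S : Box.{u}) : S.Context ⥤ BddDistLat.{u} :=
  S.contextSets ⋙ freeBool ⋙ forget₂ BoolAlg BddDistLat

/-- The natural transformation `φ^* ι' ⟶ ι` with components the restrictions `φ⁻¹ c → c`. -/
def contextSetsMap {S' S : Box.{u}} (f : S' ⟶ S) :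
    (contextMap f).monotone.functor ⋙ S'.contextSets ⟶ S.contextSets where
  app c := TypeCat.ofHom fun s : f.map ⁻¹' c.1 => (⟨f.map s.1, s.2⟩ : c.1)

/-- The homomorphism `φ^* L_{S'/I'} ⟶ L_{S/I}`. -/
def logicMap {S' S : Box.{u}} (f : S' ⟶ S) :
    (inverseImage (contextMap f)).obj S'.logic ⟶ S.logic :=
  Functor.whiskerRight (contextSetsMap f) (freeBool ⋙ forget₂ BoolAlg BddDistLat)

/-- The framed topos `(Set^{C_{S/I}}, Idl L_{S/I})`. -/
def framedObj (S : Box.{u}) : FramedTopos.{u} := ⟨S.Context, (idlMonad S.Context).free.obj S.logic⟩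

/-- The morphism of framed topoi induced by a morphism of box presentations; its internal frame
part is the composite `Idl L' ⟶ Idl (φ_* L) ⟶ φ_* (Idl L)`. -/
def framedMap {S' S : Box.{u}} (f : S' ⟶ S) : S.framedObj ⟶ S'.framedObj where
  map := contextMap f
  comap := (idlMonad S'.Context).free.map (transpose (contextMap f) (logicMap f)) ≫
    idlDirectFrame (contextMap f) S.logic

theorem logicMap_id (S : Box.{u}) (c : S.Context) (x : S.logic.obj c) :
    (logicMap (𝟙 S)).app c x = x :=
  DFunLike.congr_fun (FreeBool.hom_ext (X := (contextMap (𝟙 S) c).1) (B := FreeBool c.1)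
    (f := ((logicMap (𝟙 S)).app c).hom) (g := BoundedLatticeHom.id (FreeBool c.1))
    fun _ => rfl) x

theorem logicMap_comp {S S' S'' : Box.{u}} (f : S'' ⟶ S') (g : S' ⟶ S) (c : S.Context)
    (x : S''.logic.obj (contextMap (f ≫ g) c)) :
    (logicMap (f ≫ g)).app c x = (logicMap g).app c ((logicMap f).app (contextMap g c) x) :=
  DFunLike.congr_fun (FreeBool.hom_ext (X := (contextMap (f ≫ g) c).1) (B := FreeBool c.1)
    (f := ((logicMap (f ≫ g)).app c).hom)
    (g := ((logicMap g).app c).hom.comp ((logicMap f).app (contextMap g c)).hom)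
    fun _ => rfl) x

theorem mem_framedMap {S' S : Box.{u}} (f : S' ⟶ S) {c' : S'.Context}
    (J : IdealFamily S'.logic c') (c : S.Context) (hc : c' ≤ contextMap f c) (e : S.Context)
    (he : c ≤ e) (y : S.logic.obj e) :
    y ∈ IdealFamily.ideal (L := S.logic) ((framedMap f).comapAt J c hc) e he ↔
      ∃ x ∈ J.ideal (contextMap f e) (hc.trans ((contextMap f).monotone he)),
        y ≤ (logicMap f).app e x := by
  constructor
  · rintro ⟨s, ⟨x, hx, hs⟩, hy⟩
    refine ⟨x, hx, le_trans hy ((hs e le_rfl).trans ?_)⟩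
    exact (congrArg ((logicMap f).app e) (res_self S'.logic le_rfl x)).le
  · rintro ⟨x, hx, hy⟩
    refine ⟨_, ⟨x, hx, le_rfl⟩, le_trans hy ?_⟩
    exact (congrArg ((logicMap f).app e) (res_self S'.logic le_rfl x)).ge

/-- The functor sending `S/I` to the framed topos `(Set^{C_{S/I}}, Idl L_{S/I})`. -/
def framed : Box.{u}ᵒᵖ ⥤ FramedTopos.{u} where
  obj S := S.unop.framedObj
  map f := framedMap f.unop
  map_id S := FramedTopos.Hom.ext_at rfl fun d J c hc => IdealFamily.ext_mem fun e he y => by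
    refine (mem_framedMap (𝟙 S.unop) J c hc e he y).trans ?_
    constructor
    · rintro ⟨x, hx, hy⟩
      exact Order.Ideal.lower _ (hy.trans (logicMap_id S.unop e x).le) hx
    · intro hy
      exact ⟨y, hy, (logicMap_id S.unop e y).ge⟩
  map_comp {S S' S''} f g := FramedTopos.Hom.ext_at rfl fun d J c hc =>
    IdealFamily.ext_mem fun e he y => by
      refine (mem_framedMap (g.unop ≫ f.unop) J c hc e he y).trans ?_
      refine Iff.trans ?_ (mem_framedMap f.unop ((framedMap g.unop).comapAt J _ hc) c le_rfl e he y).symm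
      constructor
      · rintro ⟨x, hx, hy⟩
        refine ⟨(logicMap g.unop).app _ x, ?_, le_trans hy (logicMap_comp _ _ e x).le⟩
        exact (mem_framedMap g.unop J _ hc _ _ _).mpr ⟨x, hx, le_rfl⟩
      · rintro ⟨z, hz, hy⟩
        obtain ⟨x, hx, hz'⟩ := (mem_framedMap g.unop J _ hc _ _ _).mp hz
        exact ⟨x, hx, (le_trans hy (OrderHomClass.mono ((logicMap f.unop).app e).hom hz')).trans
          (logicMap_comp _ _ e x).ge⟩

/-- The external phase space functor. -/
def phaseSpace : Box.{u}ᵒᵖ ⥤ Arrow Locale.{u} := framed ⋙ FramedTopos.toArrow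

/-! ### Outcomes -/

/-- An outcome: a context `c` together with a map `c → 2`. -/
structure Outcome (S : Box.{u}) : Type u where
  ctx : S.Context
  val : ctx.1 → Bool

/-- `x ≤ y` if the context of `x` is contained in that of `y`, and `x` is the restriction of `y`. -/
instance (S : Box.{u}) : PartialOrder S.Outcome where
  le x y := ∃ h : x.ctx ≤ y.ctx, ∀ s, x.val s = y.val (Set.inclusion h s)
  le_refl x := ⟨le_rfl, fun _ => rfl⟩
  le_trans x y z h k := ⟨h.1.trans k.1, fun s => (h.2 s).trans (k.2 _)⟩
  le_antisymm x y h k := by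
    obtain ⟨c, x⟩ := x
    obtain ⟨d, y⟩ := y
    obtain rfl : c = d := le_antisymm h.1 k.1
    congr 1
    funext s
    exact h.2 s

/-- The projection of outcomes to contexts. -/
def outcomeProj (S : Box.{u}) : S.Outcome →o S.Context := ⟨Outcome.ctx, fun _ _ h => h.1⟩

/-- The map on outcomes induced by a morphism: pullback. -/
def outcomeMap {S' S : Box.{u}} (f : S' ⟶ S) : S.Outcome →o S'.Outcome where
  toFun x := ⟨contextMap f x.ctx, fun s => x.val ⟨f.map s.1, s.2⟩⟩
  monotone' _ _ h := ⟨(contextMap f).monotone h.1, fun s => h.2 ⟨f.map s.1, s.2⟩⟩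

/-- The functor sending `S/I` to the monotone projection from outcomes to contexts. -/
def outcomes : Box.{u}ᵒᵖ ⥤ Arrow Preord.{u} where
  obj S := Arrow.mk (Preord.ofHom S.unop.outcomeProj)
  map f := Arrow.homMk (Preord.ofHom (outcomeMap f.unop)) (Preord.ofHom (contextMap f.unop)) rfl

/-- The functor sending a preorder to its Alexandrov space (open sets are upper sets), viewed as a
locale. -/
def alexandrov : Preord.{u} ⥤ Locale.{u} :=
  alexDiscEquivPreord.inverse ⋙ forget₂ AlexDisc TopCat ⋙ topToLocale

/-- The functor sending `S/I` to the Alexandrov projection `X_{S/I} → C_{S/I}`. -/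
def outcomeSpace : Box.{u}ᵒᵖ ⥤ Arrow Locale.{u} := outcomes ⋙ alexandrov.mapArrow

end Box

end BoxWorld

/-!
The free Boolean algebra on a finite set `c` is atomic, its atoms being the minterms, i.e. the
complete descriptions of assignments `c → 2`. Hence an ideal of formulas is the same thing as the
set of assignments satisfying some formula of the ideal (`FreeBool.mem_ideal_iff`).

A global section of `Idl L` over the poset of contexts is determined by its diagonal values, the
ideals it contains at each context `c`; these are compatible with the inclusions of contexts and
otherwise arbitrary. So it is a set of pairs `(c, x)` with `x : c → 2`, and compatibility says that
this set is upper: global sections of `Idl L` form the frame of opens of the Alexandrov space of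
outcomes (`idlSections`). Likewise a global section of `Ω` is an upper set of contexts
(`truthSections`). Since an order isomorphism between frames is an isomorphism of frames, this
yields the isomorphisms of locales; in particular the joins obtained from the algebra structures
never have to be computed.

Under these identifications the frame homomorphisms involved become preimages: along `c ↦ φ c` for
the canonical homomorphism `Ω ⟶ φ_* Ω` (`mem_comap_truth`), along pullback of outcomes for
`F' ⟶ φ_* F` (`phaseLocaleIso_naturality`, because a formula transported along a map of variables
is true at `x` iff the original is true at the pullback of `x`), and along the projection
`(c, x) ↦ c` for `Ω ⟶ F` (`mem_toBase`).
-/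

namespace BoxWorld

/-! ### Two-valued semantics of free Boolean algebras -/

namespace FreeBool

variable {X Y : Type u}

/-- `Holds x a` means that the formula `a` is true under the two-valued assignment `x`. Truth
values are encoded as subsets of a point, so that they form a Boolean algebra in universe `u`. -/
def Holds (x : X → Bool) (a : FreeBool X) : Prop :=
  PUnit.unit.{u + 1} ∈ eval (fun t => {_p : PUnit.{u + 1} | x t = true}) a

section Holds

variable (x : X → Bool)

theorem holds_of (t : X) : Holds x (of t) ↔ x t = true := Iff.rfl

theorem holds_top : Holds x ⊤ := trivial

theorem not_holds_bot : ¬ Holds x ⊥ := fun h => h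

theorem holds_inf (a b : FreeBool X) : Holds x (a ⊓ b) ↔ Holds x a ∧ Holds x b := by
  unfold Holds
  rw [eval_inf]
  exact Iff.rfl

theorem holds_sup (a b : FreeBool X) : Holds x (a ⊔ b) ↔ Holds x a ∨ Holds x b := by
  unfold Holds
  rw [eval_sup]
  exact Iff.rfl

theorem holds_compl (a : FreeBool X) : Holds x aᶜ ↔ ¬ Holds x a := by
  unfold Holds
  rw [eval_compl]
  exact Iff.rfl

variable {x} in
theorem Holds.mono {a b : FreeBool X} (h : a ≤ b) (ha : Holds x a) : Holds x b :=
  Set.mem_of_subset_of_mem (h (Set PUnit.{u + 1}) _) ha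

theorem holds_map (f : X → Y) (y : Y → Bool) (a : FreeBool X) :
    Holds y (map f a) ↔ Holds (y ∘ f) a := by
  have h : (lift fun t => {_p : PUnit.{u + 1} | y t = true}).comp (map f) =
      lift fun t => {_p : PUnit.{u + 1} | (y ∘ f) t = true} := hom_ext fun _ => rfl
  exact iff_of_eq (congrArg (PUnit.unit ∈ ·) (DFunLike.congr_fun h a))

end Holds

/-! ### Minterms and ideals -/

section Finite

variable [Fintype X]

/-- The conjunction of literals that describes the assignment `x`. -/
def minterm (x : X → Bool) : FreeBool X :=
  Finset.univ.inf fun t => if x t then of t else (of t)ᶜ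

theorem minterm_le_literal (x : X → Bool) (t : X) :
    minterm x ≤ if x t then of t else (of t)ᶜ :=
  Finset.inf_le (Finset.mem_univ t)

/-- A minterm decides every formula, so the minterms are the atoms of the free Boolean algebra. -/
theorem minterm_decides (x : X → Bool) (a : FreeBool X) :
    (Holds x a → minterm x ≤ a) ∧ (¬ Holds x a → minterm x ≤ aᶜ) := by
  induction a using Quotient.inductionOn with
  | h a =>
    change (Holds x (mk a) → minterm x ≤ mk a) ∧ (¬ Holds x (mk a) → minterm x ≤ (mk a)ᶜ)
    induction a with
    | var t =>
      have h := minterm_le_literal x t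
      refine ⟨fun ht => ?_, fun ht => ?_⟩
      · rwa [if_pos ((holds_of x t).mp ht)] at h
      · rwa [if_neg fun h' => ht ((holds_of x t).mpr h')] at h
    | top => exact ⟨fun _ => le_top, fun h => (h (holds_top x)).elim⟩
    | bot => exact ⟨fun h => (not_holds_bot x h).elim, fun _ => le_top.trans compl_bot.ge⟩
    | inf s t hs ht =>
      refine ⟨fun h => ?_, fun h => ?_⟩
      · have h' := (holds_inf x (mk s) (mk t)).mp h
        exact le_inf (hs.1 h'.1) (ht.1 h'.2)
      · rcases not_and_or.mp (mt (holds_inf x (mk s) (mk t)).mpr h) with h' | h'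
        · exact (hs.2 h').trans (compl_le_compl (inf_le_left : mk s ⊓ mk t ≤ mk s))
        · exact (ht.2 h').trans (compl_le_compl (inf_le_right : mk s ⊓ mk t ≤ mk t))
    | sup s t hs ht =>
      refine ⟨fun h => ?_, fun h => ?_⟩
      · rcases (holds_sup x (mk s) (mk t)).mp h with h' | h'
        · exact (hs.1 h').trans (le_sup_left : mk s ≤ mk s ⊔ mk t)
        · exact (ht.1 h').trans (le_sup_right : mk t ≤ mk s ⊔ mk t)
      · have h' := not_or.mp (mt (holds_sup x (mk s) (mk t)).mpr h)
        exact (le_inf (hs.2 h'.1) (ht.2 h'.2)).trans (compl_sup (a := mk s) (b := mk t)).ge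
    | compl s hs =>
      change (Holds x (mk s)ᶜ → minterm x ≤ (mk s)ᶜ) ∧ (¬ Holds x (mk s)ᶜ → minterm x ≤ (mk s)ᶜᶜ)
      rw [holds_compl, not_not, compl_compl]
      exact hs.symm

theorem minterm_le {x : X → Bool} {a : FreeBool X} (h : Holds x a) : minterm x ≤ a :=
  (minterm_decides x a).1 h

theorem holds_minterm_iff {x y : X → Bool} : Holds y (minterm x) ↔ x = y := by
  constructor
  · intro h
    funext t
    have h' := h.mono (minterm_le_literal x t)
    cases hx : x t
    · rw [hx, if_neg Bool.false_ne_true, holds_compl, holds_of] at h'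
      exact (Bool.eq_false_of_not_eq_true h').symm
    · rw [hx, if_pos rfl, holds_of] at h'
      exact h'.symm
  · rintro rfl
    have h : ∀ s : Finset X, Holds x (s.inf fun t => if x t then of t else (of t)ᶜ) := by
      classical
      intro s
      induction s using Finset.induction_on with
      | empty => exact holds_top x
      | insert t s _ hs =>
        rw [Finset.inf_insert]
        refine (holds_inf x _ _).mpr ⟨?_, hs⟩
        split_ifs with ht
        · exact ht
        · exact (holds_compl x _).mpr ht
    exact h _

theorem sup_minterm [DecidableEq X] : Finset.univ.sup (minterm (X := X)) = ⊤ := by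
  -- Distribute the meet over the joins in `⊤ = ⨅ t, (t ⊔ tᶜ)`.
  have h : (Finset.univ.inf fun t : X => (Finset.univ : Finset Bool).sup
      fun b => if b then of t else (of t)ᶜ) = (⊤ : FreeBool X) :=
    (Finset.inf_congr rfl fun t _ => (by simp : _ = (⊤ : FreeBool X))).trans (Finset.inf_top _)
  rw [← top_le_iff, ← h, Finset.inf_sup]
  refine Finset.sup_le fun g _ => ?_
  refine le_trans ?_ (Finset.le_sup (Finset.mem_univ fun t => g t (Finset.mem_univ t)))
  exact Finset.le_inf fun t _ => Finset.inf_le (Finset.mem_attach _ ⟨t, Finset.mem_univ t⟩)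

/-- Every formula is the disjunction of the minterms below it, so membership in an ideal can be
tested on two-valued assignments. -/
theorem mem_ideal_iff (I : Order.Ideal (FreeBool X)) (a : FreeBool X) :
    a ∈ I ↔ ∀ x, Holds x a → ∃ b ∈ I, Holds x b := by
  classical
  refine ⟨fun ha x hx => ⟨a, ha, hx⟩, fun h => ?_⟩
  have ha := Finset.sup_inf_distrib_left Finset.univ (minterm (X := X)) a
  rw [sup_minterm, inf_top_eq] at ha
  rw [ha]
  -- Each `a ⊓ minterm x` is either below a member of `I` true at `x`, or equal to `⊥`.
  refine (Finset.sup_induction (p := (· ∈ I)) I.bot_mem (fun _ h _ k => Order.Ideal.sup_mem h k)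
    fun x _ => ?_)
  by_cases hx : Holds x a
  · obtain ⟨b, hb, hxb⟩ := h x hx
    exact I.lower (le_trans inf_le_right (minterm_le hxb)) hb
  · refine I.lower (le_trans (inf_le_inf_left a ((minterm_decides x a).2 hx)) ?_) I.bot_mem
    exact (inf_compl_self a).le

end Finite

end FreeBool

open TopologicalSpace Topology WithUpperSet

/-! ### Global sections as upper sets -/

/-- Whether a section of the subobject classifier is true at a stage `d` does not depend on the
earlier stage at which it is evaluated. -/
theorem mem_truth_iff {C : Type u} [PartialOrder C]
    (s : PushSection (toPoint C) (truthLattice C) PUnit.unit) {c d : C}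
    (hc : PUnit.unit ≤ toPoint C c) (hd : PUnit.unit ≤ toPoint C d) (h : c ≤ d) :
    d ∈ Truth.carrier (s.val c hc) ↔ d ∈ Truth.carrier (s.val d hd) := by
  have hs : Truth.restrict h (s.val c hc) = s.val d hd := s.res_val hc h
  rw [← hs]
  exact ⟨fun hd => ⟨hd, le_refl d⟩, fun hd => hd.1⟩

/-- Global sections of the subobject classifier of `Set^C` are the upper subsets of `C`: a section
is determined by the stages at which it is true. -/
def truthSections (C : Type u) [PartialOrder C] :
    PushSection (toPoint C) (truthLattice C) PUnit.unit ≃o Opens (WithUpperSet C) where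
  toFun s :=
    { carrier := {c | ofUpperSet c ∈ Truth.carrier (s.val (ofUpperSet c) le_rfl)}
      is_open' := IsUpperSet.isOpen_iff_isUpperSet.mpr fun c d h hc =>
        (mem_truth_iff s le_rfl le_rfl (ofUpperSet_le_iff.mpr h)).mp (Truth.upper _ h hc) }
  invFun U :=
    { val := fun c _ => show Truth c from
        { carrier := toUpperSet ⁻¹' U ∩ Set.Ici c
          upper := (IsUpperSet.isOpen_iff_isUpperSet.mp U.isOpen).inter (isUpperSet_Ici c)
          above := fun h => h.2 }
      res_val := fun {c d} _ h => Truth.ext (Set.ext fun e =>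
        ⟨fun he => ⟨he.1.1, he.2⟩, fun he => ⟨⟨he.1, h.trans he.2⟩, he.2⟩⟩) }
  left_inv s := PushSection.ext (funext fun c => funext fun hc => Truth.ext (Set.ext fun d =>
    ⟨fun hd => (mem_truth_iff s hc le_rfl hd.2).mpr hd.1, fun hd =>
      ⟨(mem_truth_iff s hc le_rfl (Truth.above _ hd)).mp hd, Truth.above _ hd⟩⟩))
  right_inv U := Opens.ext (Set.ext fun c => ⟨fun h => h.1, fun h => ⟨h, le_refl (ofUpperSet c)⟩⟩)
  map_rel_iff' {s t} := by
    constructor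
    · intro h c hc d hd
      have hcd := Truth.above _ hd
      exact (mem_truth_iff t hc le_rfl hcd).mpr
        (@h (toUpperSet d) ((mem_truth_iff s hc le_rfl hcd).mp hd))
    · intro h c hc
      exact h _ le_rfl hc

namespace Box

/-- The ideal of formulas of the context `c` contained in a global section of `Idl L`. -/
def sectionIdeal {S : Box.{u}} (s : PushSection (toPoint S.Context) (idl S.logic) PUnit.unit)
    (c : S.Context) : Order.Ideal (FreeBool c.1) :=
  IdealFamily.ideal (s.val c le_rfl) c le_rfl

/-- A global section of the ideal completion is determined by its diagonal values. -/
theorem ideal_eq_sectionIdeal {S : Box.{u}}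
    (s : PushSection (toPoint S.Context) (idl S.logic) PUnit.unit) (c : S.Context)
    (hc : PUnit.unit ≤ toPoint S.Context c) (d : S.Context) (hd : c ≤ d) :
    IdealFamily.ideal (s.val c hc) d hd = sectionIdeal s d := by
  have h := s.res_val hc hd
  exact congrArg (fun I : IdealFamily S.logic d => I.ideal d le_rfl) h

theorem map_mem_sectionIdeal {S : Box.{u}}
    (s : PushSection (toPoint S.Context) (idl S.logic) PUnit.unit) {c d : S.Context} (h : c ≤ d)
    {a : FreeBool c.1} (ha : a ∈ sectionIdeal s c) :
    FreeBool.map (Set.inclusion h) a ∈ sectionIdeal s d := by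
  rw [← ideal_eq_sectionIdeal s c le_rfl d h]
  exact IdealFamily.res_mem (s.val c le_rfl) le_rfl h ha

/-- The formulas of the context `c` that are true only at outcomes in `U`. -/
def outcomeIdeal {S : Box.{u}} (U : Set S.Outcome) (c : S.Context) :
    Order.Ideal (FreeBool c.1) where
  carrier := {a | ∀ x : c.1 → Bool, FreeBool.Holds x a → ⟨c, x⟩ ∈ U}
  lower' _ _ h ha x hx := ha x (hx.mono h)
  nonempty' := ⟨⊥, fun x hx => (FreeBool.not_holds_bot x hx).elim⟩
  directed' a ha b hb := ⟨a ⊔ b, fun x hx => ((FreeBool.holds_sup x a b).mp hx).elim (ha x) (hb x),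
    (le_sup_left : a ≤ a ⊔ b), (le_sup_right : b ≤ a ⊔ b)⟩

instance finite_context (S : Box.{u}) (c : S.Context) : Finite c.1 :=
  have := S.finite_quest
  inferInstanceAs (Finite (c.1 : Set S.quest))

theorem mem_sectionIdeal_iff {S : Box.{u}}
    (s : PushSection (toPoint S.Context) (idl S.logic) PUnit.unit) (c : S.Context)
    (a : FreeBool c.1) :
    a ∈ sectionIdeal s c ↔
      ∀ x, FreeBool.Holds x a → ∃ b ∈ sectionIdeal s c, FreeBool.Holds x b :=
  have := Fintype.ofFinite c.1
  FreeBool.mem_ideal_iff _ a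

/-- Global sections of `Idl L` are the upper sets of outcomes: a section corresponds to the set of
outcomes at which one of its formulas is true. -/
def idlSections (S : Box.{u}) :
    PushSection (toPoint S.Context) (idl S.logic) PUnit.unit ≃o Opens (WithUpperSet S.Outcome) where
  toFun s :=
    { carrier := {p | ∃ a ∈ sectionIdeal s (ofUpperSet p).ctx, FreeBool.Holds (ofUpperSet p).val a}
      is_open' := IsUpperSet.isOpen_iff_isUpperSet.mpr fun p q h => by
        rintro ⟨a, ha, hp⟩
        have hpq : ofUpperSet p ≤ ofUpperSet q := h
        refine ⟨_, map_mem_sectionIdeal s hpq.1 ha, (FreeBool.holds_map _ _ _).mpr ?_⟩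
        rwa [show (ofUpperSet q).val ∘ Set.inclusion hpq.1 = (ofUpperSet p).val from
          (funext hpq.2).symm] }
  invFun U :=
    { val := fun c _ => show IdealFamily S.logic c from
        { ideal := fun d _ => outcomeIdeal (toUpperSet ⁻¹' (U : Set (WithUpperSet S.Outcome))) d
          res_mem := fun {d e} _ h a ha x hx =>
            IsUpperSet.isOpen_iff_isUpperSet.mp U.isOpen
              (show toUpperSet (Outcome.mk d (x ∘ Set.inclusion h)) ≤ toUpperSet ⟨e, x⟩ from
                ⟨h, fun _ => rfl⟩)
              (ha _ ((FreeBool.holds_map (Set.inclusion h) x a).mp hx)) }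
      res_val := fun _ _ => rfl }
  left_inv s := PushSection.ext (funext fun c => funext fun hc => IdealFamily.ext_mem
    fun d hd a => by
      rw [ideal_eq_sectionIdeal s c hc d hd]
      exact (mem_sectionIdeal_iff s d a).symm)
  right_inv U := Opens.ext (Set.ext fun p => by
    constructor
    · rintro ⟨a, ha, hp⟩
      exact ha _ hp
    · intro hp
      have := Fintype.ofFinite (ofUpperSet p).ctx.1
      -- The minterm of the outcome is true at that outcome only, so it lies in the ideal.
      refine ⟨FreeBool.minterm (ofUpperSet p).val, fun x hx => ?_,
        FreeBool.holds_minterm_iff.mpr rfl⟩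
      rw [← FreeBool.holds_minterm_iff.mp hx]
      exact hp)
  map_rel_iff' {s t} := by
    constructor
    · intro h c hc d hd a ha
      rw [ideal_eq_sectionIdeal] at ha ⊢
      refine (mem_sectionIdeal_iff t d a).mpr fun x hx => ?_
      exact @h (toUpperSet ⟨d, x⟩) ⟨a, ha, hx⟩
    · rintro h p ⟨a, ha, hp⟩
      exact ⟨a, h _ le_rfl _ le_rfl ha, hp⟩

/-! ### The isomorphism of functors -/

/-- Global sections of the subobject classifier, as a frame, are the opens of the Alexandrov space
of stages. -/
def truthLocaleIso (C : Type u) [PartialOrder C] :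
    alexandrov.obj (Preord.of C) ≅ op ((globalSections C).obj (truth C)) :=
  Iso.op (Frm.Iso.mk (α := (globalSections C).obj (truth C))
    (β := Frm.of (Opens (WithUpperSet C))) (truthSections C))

/-- The external phase space of a box is the Alexandrov space of its outcomes. -/
def phaseLocaleIso (S : Box.{u}) :
    alexandrov.obj (Preord.of S.Outcome) ≅ FramedTopos.toLocale.obj S.framedObj :=
  Iso.op (Frm.Iso.mk (α := (globalSections S.Context).obj S.framedObj.frame)
    (β := Frm.of (Opens (WithUpperSet S.Outcome))) (idlSections S))

/-- The canonical homomorphism `Ω ⟶ φ_* Ω` sends an upper set to its preimage under `φ`. -/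
theorem mem_comap_truth {X Y : FramedTopos.{u}} (f : X ⟶ Y) {d : Y.ctx} (U : Truth d) (c : X.ctx)
    (hc : d ≤ f.map c) (e : X.ctx) :
    e ∈ Truth.carrier ((FramedTopos.base.map f).comapAt U c hc) ↔
      c ≤ e ∧ f.map e ∈ U.carrier := by
  constructor
  · rintro ⟨h, V, ⟨s, hs, hV⟩, he⟩
    refine ⟨h, ?_⟩
    rcases hs with hs | hs
    · subst hs
      exact (hV he).elim
    · exact hs
  · rintro ⟨h, he⟩
    exact ⟨h, (⊤ : Truth e), ⟨(⊤ : PushSection f.map (truthLattice X.ctx) (f.map e)), Or.inr he,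
      le_refl (⊤ : Truth e)⟩, le_refl e⟩

theorem truthLocaleIso_naturality {X Y : FramedTopos.{u}} (f : X ⟶ Y) :
    alexandrov.map (Preord.ofHom f.map) ≫ (truthLocaleIso Y.ctx).hom =
      (truthLocaleIso X.ctx).hom ≫ FramedTopos.toLocale.map (FramedTopos.base.map f) := by
  refine Quiver.Hom.unop_inj (Frm.ext fun s => Opens.ext (Set.ext fun c => ?_))
  have h (c : X.ctx) := (mem_comap_truth f (s.val (f.map c) le_rfl) c le_rfl c).trans
    (and_iff_right le_rfl)
  exact (h (ofUpperSet c)).symm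

theorem phaseLocaleIso_naturality {S' S : Box.{u}} (f : S' ⟶ S) :
    alexandrov.map (Preord.ofHom (outcomeMap f)) ≫ (phaseLocaleIso S').hom =
      (phaseLocaleIso S).hom ≫ FramedTopos.toLocale.map (framedMap f) := by
  refine Quiver.Hom.unop_inj (Frm.ext fun s => Opens.ext (Set.ext fun p => ?_))
  have h := mem_framedMap f (s.val (contextMap f (ofUpperSet p).ctx) le_rfl) (ofUpperSet p).ctx
    le_rfl (ofUpperSet p).ctx le_rfl
  constructor
  · rintro ⟨a, ha, hp⟩
    exact ⟨_, (h _).mpr ⟨a, ha, le_rfl⟩, (FreeBool.holds_map _ (ofUpperSet p).val a).mpr hp⟩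
  · rintro ⟨b, hb, hp⟩
    obtain ⟨a, ha, hba⟩ := (h b).mp hb
    exact ⟨a, ha, (FreeBool.holds_map _ (ofUpperSet p).val a).mp (hp.mono hba)⟩

/-- The formulas of the context `c` in the image of a truth value in `Idl L` are `⊥` and, where the
truth value is true, all others. -/
theorem mem_toBase (S : Box.{u})
    (s : PushSection (toPoint S.Context) (truthLattice S.Context) PUnit.unit) (c : S.Context)
    (a : FreeBool c.1) :
    a ∈ IdealFamily.ideal (L := S.logic)
        ((FramedTopos.toBase.app S.framedObj).comapAt (s.val c le_rfl) c le_rfl) c le_rfl ↔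
      a = ⊥ ∨ c ∈ Truth.carrier (s.val c le_rfl) := by
  constructor
  · rintro ⟨K, ⟨t, ht, hK⟩, ha⟩
    rcases ht with ht | ht
    · subst ht
      exact Or.inl (le_bot_iff.mp (hK c le_rfl ha))
    · exact Or.inr ht
  · rintro (ha | hc)
    · subst ha
      exact Order.Ideal.bot_mem _
    · exact ⟨(⊤ : IdealFamily S.logic c), ⟨(⊤ : PushSection OrderHom.id (idl S.logic) c),
        Or.inr hc, le_refl (⊤ : IdealFamily S.logic c)⟩, trivial⟩

theorem phaseLocaleIso_proj (S : Box.{u}) :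
    (phaseLocaleIso S).hom ≫ FramedTopos.toLocale.map (FramedTopos.toBase.app S.framedObj) =
      alexandrov.map (Preord.ofHom S.outcomeProj) ≫ (truthLocaleIso S.Context).hom := by
  refine Quiver.Hom.unop_inj (Frm.ext fun s => Opens.ext (Set.ext fun p => ?_))
  constructor
  · rintro ⟨a, ha, hp⟩
    exact (mem_toBase S s _ a).mp ha |>.resolve_left fun h0 => FreeBool.not_holds_bot _ (h0 ▸ hp)
  · intro hp
    exact ⟨⊤, (mem_toBase S s _ ⊤).mpr (Or.inr hp), FreeBool.holds_top _⟩

/-- The comparison of the two functors at a box. -/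
def arrowIso (S : Box.{u}) :
    outcomeSpace.obj (op S) ≅ phaseSpace.obj (op S) :=
  Arrow.isoMk (phaseLocaleIso S) (truthLocaleIso S.Context) (phaseLocaleIso_proj S)

/-- The functors of outcomes and of external phase spaces are naturally isomorphic. -/
def outcomeSpaceIso : outcomeSpace.{u} ≅ phaseSpace.{u} :=
  NatIso.ofComponents (fun S => arrowIso S.unop) fun {S T} f => by
    ext
    · exact phaseLocaleIso_naturality f.unop
    · exact truthLocaleIso_naturality (framedMap f.unop)

end Box

end BoxWorld

theorem mainTheorem5 :
    Nonempty (BoxWorld.Box.outcomeSpace.{u} ≅ BoxWorld.Box.phaseSpace.{u}) :=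
  ⟨BoxWorld.Box.outcomeSpaceIso⟩
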